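/- Let $\hat{\mathbb C}=\mathbb C\cup\{\infty\}$ be the Riemann sphere, $\tau(z)=e^{2\pi i/n}z$, and let $\omega$ be the Fubini–Study form on $\mathbb{CP}^k$. A holomorphic sphere is a holomorphic map $u:\hat{\mathbb C}\to\mathbb{CP}^k$; it is simple if it is not multiply covered, and its class is $\omega$-minimal if $0<\int u^*\omega=\inf\{\int v^*\omega : v \text{ a nonconstant holomorphic sphere in } \mathbb{CP}^k\}$. Let $\tilde\sigma(z_1,\dots,z_n)=(z_n,z_1,\dots,z_{n-1})$ on $\mathbb C^n$. (1) Let $n\ge 2$, let $\sigma_1$ be the map of $\mathbb{CP}^{n-1}$ induced by $\tilde\sigma$, and put $Z_B=(e^{2\pi i/n},e^{4\pi i/n},\dots,e^{2\pi i(n-1)/n},1)$, $Z_A=(1,\dots,1)$, $B=[Z_B]$ (the $n$-polygon) and $A=[Z_A]$ (the total collision). Then the line $u_0(z)=[Z_B+zZ_A]$, $u_0(\infty)=A$, is a simple holomorphic sphere of $\omega$-minimal class in $\mathbb{CP}^{n-1}$, and every simple holomorphic sphere $u$ of $\omega$-minimal class in $\mathbb{CP}^{n-1}$ with $u(0)=B$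 and $u(\infty)=A$ satisfies $u(z)=u_0(\zeta z)$ for some $\zeta\in\mathbb C\setminus\{0\}$ and is choreographic: $u\circ\tau=\sigma_1\circ u$. (2) Let $n=2m$ with $m\ge2$, and let $f:\mathbb C^n\to\mathbb C^n$ be any unitary linear map (Lim's coordinates) $W=f(Z)$ whose last coordinate is $w_n=\frac1{\sqrt n}\sum_i z_i$; write $w(Z)=(w_1(Z),\dots,w_{n-1}(Z))$. Let $\sigma_2$ be the map of $\mathbb{CP}^{n-2}$ induced by $f\circ\tilde\sigma\circ f^{-1}$ on $\{w_n=0\}\cong\mathbb C^{n-1}$. Put $Z_A=(e^{2\pi i/m},e^{4\pi i/m},\dots,1,e^{2\pi i/m},e^{4\pi i/m},\dots,1)$, let $Z_B$ be as in (1), and let $A=[w(Z_A)]$ (the binary total collision) and $B=[w(Z_B)]$ (the $n$-polygon). Then the line $u_0(z)=[w(Z_A)+z\,w(Z_B)]$, $u_0(\infty)=B$, is a simple holomorphic sphere of $\omega$-minimal class in $\mathbb{CP}^{n-2}$, and every simple holomorphic sphere $u$ of $\omega$-minimal class in $\mathbb{CP}^{n-2}$ with $u(0)=A$ and $u(\infty)=B$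 satisfies $u(z)=u_0(\zeta z)$ for some $\zeta\in\mathbb C\setminus\{0\}$ and is choreographic: $u\circ\tau=\sigma_2\circ u$. -/

import Mathlib

open scoped LinearAlgebra.Projectivization OnePoint InnerProductSpace Topology

namespace ChoreographicSphere

noncomputable section

/-! ### Holomorphic spheres in projective space

The Riemann sphere is `OnePoint ℂ`, with the charts `z` and `1/z`. -/

section Holomorphic

variable {V : Type*} [NormedAddCommGroup V] [NormedSpace ℂ V]

/-- The parametrisation `w ↦ 1/w` of the Riemann sphere minus `0`, with `0 ↦ ∞`. -/
def chartAtInfty (w : ℂ) : OnePoint ℂ := if w = 0 then ∞ else ((w⁻¹ : ℂ) : OnePoint ℂ)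

/-- `U` is a holomorphic, nowhere zero lift of `g` to `V ∖ {0}` near `z₀`. -/
def IsLocalLift (g : ℂ → ℙ ℂ V) (U : ℂ → V) (z₀ : ℂ) : Prop :=
  AnalyticAt ℂ U z₀ ∧ ∀ᶠ z in 𝓝 z₀, ∃ h : U z ≠ 0, g z = Projectivization.mk ℂ (U z) h

/-- `u` is a holomorphic map from the Riemann sphere to the projective space of `V`, for the
standard complex structures: in both charts of the sphere it has local holomorphic lifts through
the holomorphic submersion `V ∖ {0} → ℙ ℂ V`. (Away from the centre of the chart at infinity the
two charts are holomorphically related, so that the second clause is only needed there.) -/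
def IsHolomorphicSphere (u : OnePoint ℂ → ℙ ℂ V) : Prop :=
  (∀ z₀ : ℂ, ∃ U : ℂ → V, IsLocalLift (fun z => u (z : OnePoint ℂ)) U z₀) ∧
    ∃ U : ℂ → V, IsLocalLift (fun w => u (chartAtInfty w)) U 0

/-- `φ` is a holomorphic self-map of the Riemann sphere, identified with the projective line by
`z ↦ [z : 1]`, `∞ ↦ [1 : 0]`. -/
def IsHolomorphicSelfMap (φ : OnePoint ℂ → OnePoint ℂ) : Prop :=
  IsHolomorphicSphere (fun x => OnePoint.equivProjectivization ℂ (φ x))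

/-- A sphere is simple if it is not multiply covered: it does not factor as `v ∘ φ` with `v` a
holomorphic sphere and `φ` a holomorphic self-map of the Riemann sphere that is not of degree one
(a holomorphic self-map of the Riemann sphere has degree one exactly if it is injective). -/
def IsSimple (u : OnePoint ℂ → ℙ ℂ V) : Prop :=
  ∀ (v : OnePoint ℂ → ℙ ℂ V) (φ : OnePoint ℂ → OnePoint ℂ),
    IsHolomorphicSphere v → IsHolomorphicSelfMap φ → u = v ∘ φ → Function.Injective φ

end Holomorphic

/-! ### The Fubini–Study form and the ω-minimal class -/

section Symplectic

variable {V : Type*} [NormedAddCommGroup V] [InnerProductSpace ℂ V]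

/-- The Fubini–Study form at the point `[p]` of projective space, on the tangent vectors that are
the images of `a` and `b`. On the unit sphere it is the imaginary part of the Hermitian product of
the components orthogonal to `p`. -/
def fubiniStudy (p a b : V) : ℝ :=
  (⟪a, b⟫_ℂ / (‖p‖ : ℂ) ^ 2 - ⟪a, p⟫_ℂ * ⟪p, b⟫_ℂ / (‖p‖ : ℂ) ^ 4).im

/-- The Fubini–Study form does not see the choice of the lift: rescaling the point by `c` and
changing the lifted tangent vectors accordingly does not change it. -/
theorem fubiniStudy_rescale (p a b : V) (hp : p ≠ 0) (c α β : ℂ) (hc : c ≠ 0) :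
    fubiniStudy (c • p) (c • a + α • p) (c • b + β • p) = fubiniStudy p a b := by
  have hp' : (‖p‖ : ℂ) ≠ 0 := by simpa using hp
  have hc' : (‖c‖ : ℂ) ≠ 0 := by simpa using hc
  have hcc : (starRingEnd ℂ) c * c = (‖c‖ : ℂ) ^ 2 := by
    rw [mul_comm, Complex.mul_conj, Complex.normSq_eq_norm_sq]; push_cast; rfl
  have hpp : ⟪p, p⟫_ℂ = (‖p‖ : ℂ) ^ 2 := inner_self_eq_norm_sq_to_K p
  unfold fubiniStudy
  congr 1
  simp only [inner_add_left, inner_add_right, inner_smul_left, inner_smul_right, norm_smul, hpp]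
  push_cast
  field_simp
  linear_combination
    (⟪a, b⟫_ℂ * (‖p‖ : ℂ) ^ 2 * (‖c‖ : ℂ) ^ 2
      - ⟪a, p⟫_ℂ * ⟪p, b⟫_ℂ * ((starRingEnd ℂ) c * c + (‖c‖ : ℂ) ^ 2)
      - (‖p‖ : ℂ) ^ 2 * (starRingEnd ℂ) c * β * ⟪a, p⟫_ℂ
      - (‖p‖ : ℂ) ^ 2 * c * (starRingEnd ℂ) α * ⟪p, b⟫_ℂ
      - (‖p‖ : ℂ) ^ 4 * (starRingEnd ℂ) α * β) * hcc

open Classical in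
/-- The density of `u^*ω` with respect to `dx ∧ dy` at `z`, for `ω` the Fubini–Study form:
`ω(∂ₓu, ∂ᵧu)`, computed in a holomorphic lift `U`, for which `∂ₓU = U'` and `∂ᵧU = i U'`. -/
def areaDensity (u : OnePoint ℂ → ℙ ℂ V) (z : ℂ) : ℝ :=
  if h : ∃ U : ℂ → V, IsLocalLift (fun w => u (w : OnePoint ℂ)) U z then
    fubiniStudy (h.choose z) (deriv h.choose z) (Complex.I • deriv h.choose z)
  else 0

/-- The density can be computed in any local holomorphic lift. -/
theorem areaDensity_eq (u : OnePoint ℂ → ℙ ℂ V) (z : ℂ) (U : ℂ → V)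
    (hU : IsLocalLift (fun w => u (w : OnePoint ℂ)) U z) :
    areaDensity u z = fubiniStudy (U z) (deriv U z) (Complex.I • deriv U z) := by
  have h : ∃ U : ℂ → V, IsLocalLift (fun w => u (w : OnePoint ℂ)) U z := ⟨U, hU⟩
  rw [areaDensity, dif_pos h]
  obtain ⟨hWa, hWe⟩ := h.choose_spec
  set W := h.choose
  obtain ⟨hUa, hUe⟩ := hU
  obtain ⟨hU0, -⟩ := hUe.self_of_nhds
  have hUUz : ⟪U z, U z⟫_ℂ ≠ 0 := by simpa using hU0
  let c : ℂ → ℂ := fun w => ⟪U z, W w⟫_ℂ / ⟪U z, U w⟫_ℂ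
  have hd : DifferentiableAt ℂ (fun w => ⟪U z, U w⟫_ℂ) z :=
    (innerSL ℂ (U z)).differentiableAt.comp z hUa.differentiableAt
  have hn : DifferentiableAt ℂ (fun w => ⟪U z, W w⟫_ℂ) z :=
    (innerSL ℂ (U z)).differentiableAt.comp z hWa.differentiableAt
  have hcd : DifferentiableAt ℂ c z := hn.div hd hUUz
  have hWU : ∀ᶠ w in 𝓝 z, W w = c w • U w ∧ W w ≠ 0 := by
    filter_upwards [hWe, hUe, hd.continuousAt.eventually_ne hUUz] with w h1 h2 h3
    obtain ⟨k1, e1⟩ := h1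
    obtain ⟨k2, e2⟩ := h2
    rw [e1] at e2
    obtain ⟨a, ha⟩ := (Projectivization.mk_eq_mk_iff' ℂ _ _ k1 k2).1 e2
    refine ⟨?_, k1⟩
    have : c w = a := by
      simp only [c, ← ha, inner_smul_right]
      exact mul_div_cancel_right₀ a h3
    rw [this, ha]
  have hz := hWU.self_of_nhds
  have hc0 : c z ≠ 0 := by
    intro h0
    exact hz.2 (by rw [hz.1, h0, zero_smul])
  have hder : deriv W z = c z • deriv U z + deriv c z • U z := by
    have e : W =ᶠ[𝓝 z] fun w => c w • U w := hWU.mono fun w hw => hw.1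
    rw [e.deriv_eq, deriv_fun_smul hcd hUa.differentiableAt]
  rw [hder, hz.1]
  have := fubiniStudy_rescale (U z) (deriv U z) (Complex.I • deriv U z) hU0 (c z) (deriv c z)
    (Complex.I * deriv c z) hc0
  rw [← this]
  congr 1
  rw [smul_add, smul_smul, smul_smul, smul_smul, mul_comm Complex.I (c z)]

/-- The symplectic area `⟨ω, [u]⟩ = ∫ u^*ω` of a holomorphic sphere. The integral is over the
finite plane, whose complement in the Riemann sphere is one point. -/
def symplecticArea (u : OnePoint ℂ → ℙ ℂ V) : ℝ :=
  ∫ z : ℂ, areaDensity u z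

/-- The class of `u` is ω-minimal: its area is positive, and is the infimum of the areas of the
nonconstant holomorphic spheres. -/
def IsOmegaMinimal (u : OnePoint ℂ → ℙ ℂ V) : Prop :=
  0 < symplecticArea u ∧
    IsGLB {a : ℝ | ∃ v : OnePoint ℂ → ℙ ℂ V,
      IsHolomorphicSphere v ∧ (¬ ∃ c, ∀ x, v x = c) ∧ symplecticArea v = a} (symplecticArea u)

/-- Simple holomorphic spheres in the ω-minimal class. -/
structure IsSimpleMinimalSphere (u : OnePoint ℂ → ℙ ℂ V) : Prop where
  holomorphic : IsHolomorphicSphere u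
  simple : IsSimple u
  minimal : IsOmegaMinimal u

/-- `u` is the parametrised projective line `u z = [v + z w]`, `u ∞ = [w]`. -/
def IsParametrizedLine (v w : V) (u : OnePoint ℂ → ℙ ℂ V) : Prop :=
  (∀ z : ℂ, ∃ h : v + z • w ≠ 0, u (z : OnePoint ℂ) = Projectivization.mk ℂ (v + z • w) h) ∧
    ∃ h : w ≠ 0, u ∞ = Projectivization.mk ℂ w h

end Symplectic

/-! ### Choreographic symmetry -/

/-- Multiplication by `c` on the Riemann sphere, fixing `∞`. -/
def dilation (c : ℂ) : OnePoint ℂ → OnePoint ℂ := OnePoint.map fun z => c * z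

/-- The rotation `τ z = e^{2πi/n} z` of the Riemann sphere. -/
def tau (n : ℕ) : OnePoint ℂ → OnePoint ℂ := dilation (Complex.exp (2 * Real.pi * Complex.I / n))

/-- `u ∘ τ = σ ∘ u`. -/
def IsChoreographic {X : Type*} (n : ℕ) (σ : X → X) (u : OnePoint ℂ → X) : Prop :=
  u ∘ tau n = σ ∘ u

/-- The cyclic permutation `(z₁, …, zₙ) ↦ (zₙ, z₁, …, zₙ₋₁)` of `ℂⁿ`. -/
def sigmaTilde (n : ℕ) : EuclideanSpace ℂ (Fin n) ≃ₗᵢ[ℂ] EuclideanSpace ℂ (Fin n) :=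
  LinearIsometryEquiv.piLpCongrLeft 2 ℂ ℂ (finRotate n)

theorem sigmaTilde_apply (n : ℕ) (Z : EuclideanSpace ℂ (Fin n)) (i : Fin n) :
    sigmaTilde n Z i = Z ((finRotate n).symm i) := rfl

/-- The map induced by the cyclic permutation on the projective space of `ℂⁿ`. -/
def sigma₁ (n : ℕ) :
    ℙ ℂ (EuclideanSpace ℂ (Fin n)) → ℙ ℂ (EuclideanSpace ℂ (Fin n)) :=
  Projectivization.map (sigmaTilde n).toLinearEquiv.toLinearMap (sigmaTilde n).injective

/-- Unitary coordinates `W = f(Z)` on `ℂⁿ`, `n = k + 1`, whose last coordinate is the normalised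
sum `n^{-1/2} ∑ zᵢ`. -/
structure LimCoordinates (k : ℕ) where
  f : EuclideanSpace ℂ (Fin (k + 1)) ≃ₗᵢ[ℂ] EuclideanSpace ℂ (Fin (k + 1))
  last_eq : ∀ Z, f Z (Fin.last k) = (∑ i, Z i) / (Real.sqrt (k + 1 : ℝ) : ℂ)

/-- Such coordinates exist. -/
theorem LimCoordinates.nonempty (k : ℕ) : Nonempty (LimCoordinates k) := by
  let s : ℂ := (Real.sqrt (k + 1 : ℝ) : ℂ)
  have hpos : (0 : ℝ) < k + 1 := by positivity
  have hs : s * s = (k + 1 : ℂ) := by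
    simp only [s]
    rw [← Complex.ofReal_mul, Real.mul_self_sqrt hpos.le]; push_cast; rfl
  have hs0 : s ≠ 0 := by
    simp only [s, ne_eq, Complex.ofReal_eq_zero]; exact (Real.sqrt_pos.2 hpos).ne'
  have hsc : (starRingEnd ℂ) s = s := Complex.conj_ofReal _
  let e : EuclideanSpace ℂ (Fin (k + 1)) := WithLp.toLp 2 fun _ => s⁻¹
  have hinner : ∀ Z : EuclideanSpace ℂ (Fin (k + 1)), ⟪e, Z⟫_ℂ = (∑ i, Z i) / s := by
    intro Z
    simp [e, PiLp.inner_apply, hsc, Finset.sum_mul, div_eq_mul_inv]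
  have hee : ⟪e, e⟫_ℂ = 1 := by
    rw [hinner]
    simp only [e, Finset.sum_const, Finset.card_univ, Fintype.card_fin, nsmul_eq_mul]
    push_cast
    rw [← hs]; field_simp
  have hnorm : ‖e‖ = 1 := by
    have h1 := inner_self_eq_norm_sq_to_K (𝕜 := ℂ) e
    rw [hee] at h1
    have h2 : ‖e‖ ^ 2 = 1 := by
      have := congrArg Complex.re h1
      simpa [← Complex.ofReal_pow] using this.symm
    nlinarith [norm_nonneg e]
  have horth : Orthonormal ℂ (({Fin.last k} : Set (Fin (k + 1))).domRestrict fun _ => e) := by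
    refine ⟨fun i => hnorm, fun i j hij => ?_⟩
    exact absurd (Subsingleton.elim i j) hij
  obtain ⟨b, hb⟩ := horth.exists_orthonormalBasis_extension_of_card_eq
    (by simp) (v := fun _ => e)
  refine ⟨⟨b.repr, fun Z => ?_⟩⟩
  rw [OrthonormalBasis.repr_apply_apply, hb _ rfl, hinner]

/-- Forgetting the last coordinate. -/
def dropLast (k : ℕ) : EuclideanSpace ℂ (Fin (k + 1)) →ₗ[ℂ] EuclideanSpace ℂ (Fin k) where
  toFun W := WithLp.toLp 2 fun i => W i.castSucc
  map_add' _ _ := rfl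
  map_smul' _ _ := rfl

/-- The embedding `(w₁, …, wₖ) ↦ (w₁, …, wₖ, 0)`. -/
def appendZero (k : ℕ) : EuclideanSpace ℂ (Fin k) →ₗ[ℂ] EuclideanSpace ℂ (Fin (k + 1)) where
  toFun w := WithLp.toLp 2 (Fin.snoc (α := fun _ => ℂ) (fun i => w i) 0)
  map_add' v w := by
    ext i
    refine Fin.lastCases ?_ (fun j => ?_) i <;> simp
  map_smul' c w := by
    ext i
    refine Fin.lastCases ?_ (fun j => ?_) i <;> simp

theorem dropLast_eq_zero {k : ℕ} {W : EuclideanSpace ℂ (Fin (k + 1))} (h : dropLast k W = 0)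
    (hl : W (Fin.last k) = 0) : W = 0 := by
  ext i
  refine Fin.lastCases hl (fun j => ?_) i
  exact congrArg (fun v : EuclideanSpace ℂ (Fin k) => v j) h

namespace LimCoordinates

variable {k : ℕ} (L : LimCoordinates k)

/-- The linear map `w ↦ (f ∘ σ̃ ∘ f⁻¹)(w, 0)` on `ℂᵏ`, the last coordinate (which is `0`) being
dropped again. -/
def permutation : EuclideanSpace ℂ (Fin k) →ₗ[ℂ] EuclideanSpace ℂ (Fin k) :=
  dropLast k ∘ₗ L.f.toLinearEquiv.toLinearMap ∘ₗ (sigmaTilde (k + 1)).toLinearEquiv.toLinearMap ∘ₗ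
    L.f.symm.toLinearEquiv.toLinearMap ∘ₗ appendZero k

theorem last_permuted (w : EuclideanSpace ℂ (Fin k)) :
    L.f (sigmaTilde (k + 1) (L.f.symm (appendZero k w))) (Fin.last k) = 0 := by
  have h1 := L.last_eq (L.f.symm (appendZero k w))
  rw [LinearIsometryEquiv.apply_symm_apply] at h1
  have h0 : appendZero k w (Fin.last k) = 0 := by simp [appendZero]
  rw [L.last_eq]
  rw [h0] at h1
  rw [h1]
  congr 1
  exact Equiv.sum_comp (finRotate (k + 1)).symm (fun i => L.f.symm (appendZero k w) i)

theorem permutation_injective : Function.Injective L.permutation := by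
  rw [injective_iff_map_eq_zero]
  intro w hw
  have h := dropLast_eq_zero (show dropLast k _ = 0 from hw) (L.last_permuted w)
  have h' : appendZero k w = 0 := by
    simpa using h
  ext i
  have := congrArg (fun v : EuclideanSpace ℂ (Fin (k + 1)) => v i.castSucc) h'
  simpa [appendZero] using this

/-- The map induced by the cyclic permutation on `ℂP^{n-2}`, `n = k + 1`. -/
def sigma₂ : ℙ ℂ (EuclideanSpace ℂ (Fin k)) → ℙ ℂ (EuclideanSpace ℂ (Fin k)) :=
  Projectivization.map L.permutation L.permutation_injective

/-- The first `n - 1` coordinates `(w₁(Z), …, w_{n-1}(Z))` of `f(Z)`. -/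
def coords (Z : EuclideanSpace ℂ (Fin (k + 1))) : EuclideanSpace ℂ (Fin k) := dropLast k (L.f Z)

theorem coords_ne_zero {Z : EuclideanSpace ℂ (Fin (k + 1))} (hZ : Z ≠ 0) (hc : ∑ i, Z i = 0) :
    L.coords Z ≠ 0 := by
  intro h
  refine hZ ?_
  have := dropLast_eq_zero h (by rw [L.last_eq, hc, zero_div])
  simpa using this

end LimCoordinates

/-! ### The configurations -/

/-- `(e^{2πi/m}, e^{4πi/m}, e^{6πi/m}, …)` in `ℂⁿ`, with `j`-th entry `e^{2πij/m}`, `1 ≤ j ≤ n`. -/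
def rootVector (n m : ℕ) : EuclideanSpace ℂ (Fin n) :=
  WithLp.toLp 2 fun j => Complex.exp (2 * Real.pi * Complex.I * ((j : ℕ) + 1) / m)

/-- `(1, 1, …, 1)`. -/
def totalCollision (n : ℕ) : EuclideanSpace ℂ (Fin n) := WithLp.toLp 2 fun _ => 1

/-- The regular `n`-gon `(e^{2πi/n}, e^{4πi/n}, …, 1)`. -/
def polygon (n : ℕ) : EuclideanSpace ℂ (Fin n) := rootVector n n

/-- The regular `m`-gon run through twice,
`(e^{2πi/m}, e^{4πi/m}, …, 1, e^{2πi/m}, e^{4πi/m}, …, 1)`, for `n = 2m`. -/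
def binaryCollision (n m : ℕ) : EuclideanSpace ℂ (Fin n) := rootVector n m

theorem rootVector_ne_zero (n m : ℕ) [NeZero n] : rootVector n m ≠ 0 := fun h =>
  Complex.exp_ne_zero _ (congrArg (fun v : EuclideanSpace ℂ (Fin n) => v 0) h)

theorem totalCollision_ne_zero (n : ℕ) [NeZero n] : totalCollision n ≠ 0 := fun h =>
  one_ne_zero (congrArg (fun v : EuclideanSpace ℂ (Fin n) => v 0) h)

theorem sum_rootVector (n m : ℕ) (hm : 2 ≤ m) (hmn : m ∣ n) : ∑ j, rootVector n m j = 0 := by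
  have hm0 : m ≠ 0 := by omega
  have hζ := Complex.isPrimitiveRoot_exp m hm0
  set ζ := Complex.exp (2 * Real.pi * Complex.I / m) with hζd
  have hj : ∀ j : Fin n, rootVector n m j = ζ * ζ ^ (j : ℕ) := by
    intro j
    simp only [rootVector]
    rw [← pow_succ', hζd, ← Complex.exp_nat_mul]
    congr 1
    push_cast
    ring
  have hζn : ζ ^ n = 1 := by
    obtain ⟨q, rfl⟩ := hmn
    rw [pow_mul, hζ.pow_eq_one, one_pow]
  rw [Finset.sum_congr rfl fun j _ => hj j, ← Finset.mul_sum,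
    Fin.sum_univ_eq_sum_range (fun j => ζ ^ j) n]
  have h1 : ζ - 1 ≠ 0 := sub_ne_zero.2 (hζ.ne_one (by omega))
  have h2 := geom_sum_mul ζ n
  rw [hζn, sub_self] at h2
  rw [(mul_eq_zero.1 h2).resolve_right h1, mul_zero]

/-- The total collision configuration `[1 : … : 1]` in `ℂP^{n-1}`. -/
def totalCollisionPoint (n : ℕ) [NeZero n] : ℙ ℂ (EuclideanSpace ℂ (Fin n)) :=
  Projectivization.mk ℂ (totalCollision n) (totalCollision_ne_zero n)

/-- The `n`-polygon configuration in `ℂP^{n-1}`. -/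
def polygonPoint (n : ℕ) [NeZero n] : ℙ ℂ (EuclideanSpace ℂ (Fin n)) :=
  Projectivization.mk ℂ (polygon n) (rootVector_ne_zero n n)

/-- The binary total collision configuration in `ℂP^{n-2}`, for `n = k + 1 = 2m`. -/
def LimCoordinates.binaryCollisionPoint {k : ℕ} (L : LimCoordinates k) (m : ℕ) (hm : 2 ≤ m)
    (hn : k + 1 = 2 * m) : ℙ ℂ (EuclideanSpace ℂ (Fin k)) :=
  Projectivization.mk ℂ (L.coords (binaryCollision (k + 1) m))
    (L.coords_ne_zero (rootVector_ne_zero (k + 1) m)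
      (sum_rootVector (k + 1) m hm (Dvd.intro_left 2 hn.symm)))

/-- The `n`-polygon configuration in `ℂP^{n-2}`, for `n = k + 1`. -/
def LimCoordinates.polygonPoint {k : ℕ} (L : LimCoordinates k) (hk : 2 ≤ k + 1) :
    ℙ ℂ (EuclideanSpace ℂ (Fin k)) :=
  Projectivization.mk ℂ (L.coords (polygon (k + 1)))
    (L.coords_ne_zero (rootVector_ne_zero (k + 1) (k + 1))
      (sum_rootVector (k + 1) (k + 1) hk dvd_rfl))

end

end ChoreographicSphere

/-! A holomorphic sphere has a global lift `P`: entire, nowhere zero, equal to `z ^ d • H (1 / z)`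
near infinity (`exists_isGlobalLift`). The function `logGrad P`, which is `∂ log ‖P‖²`, has the
Fubini–Study density as its `∂̄`-derivative and is `d / z + O(z⁻²)` at infinity, so Green's theorem
makes the area proportional to the degree `d` (`symplecticArea_mul`). Only the proportionality and
the positivity of the area of a line are needed, never the value of that area.

Degree zero means constant, and lines have degree one; hence the minimal spheres are those of degree
one. By Liouville a lift of degree one is affine, so the values at `0` and `∞` determine the sphere
up to `z ↦ ζ z`.

The symmetry is linear algebra: both prescribed points are eigenlines of the cyclic permutation, and
the quotient of the two eigenvalues is `e^{2πi/n}`. The permutation therefore acts on the line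
through them as the rotation `τ`, which commutes with `z ↦ ζ z`. -/

namespace ChoreographicSphere

/-! ### Green's theorem and integrability on the plane -/

/-- The integrals over large squares converge to the integral over the plane. -/
theorem tendsto_integral_square {ρ : ℂ → ℂ} (hρ : MeasureTheory.Integrable ρ) :
    Filter.Tendsto (fun R : ℝ => ∫ x : ℝ in (-R)..R, ∫ y : ℝ in (-R)..R, ρ (x + y * Complex.I))
      Filter.atTop (𝓝 (∫ z, ρ z)) := by
  have hmp := Complex.volume_preserving_equiv_real_prod.symm
  have hint : MeasureTheory.Integrable (fun p : ℝ × ℝ => ρ (p.1 + p.2 * Complex.I)) := by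
    have := (hmp.integrable_comp_emb (MeasurableEquiv.measurableEmbedding _)).2 hρ
    refine this.congr (Filter.Eventually.of_forall fun p => ?_)
    simp [Complex.measurableEquivRealProd_symm_apply, Complex.mk_eq_add_mul_I]
  have hval : ∫ z, ρ z = ∫ p : ℝ × ℝ, ρ (p.1 + p.2 * Complex.I) := by
    rw [← hmp.integral_comp (MeasurableEquiv.measurableEmbedding _)]
    refine MeasureTheory.integral_congr_ae (Filter.Eventually.of_forall fun p => ?_)
    simp [Complex.measurableEquivRealProd_symm_apply, Complex.mk_eq_add_mul_I]
  have hcover : MeasureTheory.AECover (MeasureTheory.volume : MeasureTheory.Measure (ℝ × ℝ))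
      Filter.atTop (fun R : ℝ => Set.Ioc (-R) R ×ˢ Set.Ioc (-R) R) := by
    refine ⟨Filter.Eventually.of_forall fun p => ?_, fun R => measurableSet_Ioc.prod measurableSet_Ioc⟩
    filter_upwards [Filter.eventually_gt_atTop |p.1|, Filter.eventually_gt_atTop |p.2|] with R h1 h2
    rw [abs_lt] at h1 h2
    exact ⟨⟨h1.1, h1.2.le⟩, ⟨h2.1, h2.2.le⟩⟩
  rw [hval]
  refine (hcover.integral_tendsto_of_countably_generated hint).congr' ?_
  filter_upwards [Filter.eventually_ge_atTop 0] with R hR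
  have hle : -R ≤ R := by linarith
  rw [intervalIntegral.integral_of_le hle, MeasureTheory.Measure.volume_eq_prod,
    MeasureTheory.setIntegral_prod _ hint.integrableOn]
  refine MeasureTheory.integral_congr_ae (Filter.Eventually.of_forall fun x => ?_)
  exact (intervalIntegral.integral_of_le hle).symm

theorem norm_add_mul_I_ge_im (x R : ℝ) : |R| ≤ ‖(x : ℂ) + R * Complex.I‖ := by
  simpa using Complex.abs_im_le_norm ((x : ℂ) + R * Complex.I)

theorem norm_add_mul_I_ge_re (R y : ℝ) : |R| ≤ ‖(R : ℂ) + y * Complex.I‖ := by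
  simpa using Complex.abs_re_le_norm ((R : ℂ) + y * Complex.I)

/-- Green's theorem on the plane for a function that decays quadratically. -/
theorem integral_eq_zero_of_dbar {f ρ : ℂ → ℂ} (hf : Differentiable ℝ f)
    (hfρ : ∀ z, Complex.I * fderiv ℝ f z 1 - fderiv ℝ f z Complex.I = ρ z)
    (hρ : MeasureTheory.Integrable ρ) {C r : ℝ} (hC : ∀ z, r ≤ ‖z‖ → ‖f z‖ ≤ C / ‖z‖ ^ 2) :
    ∫ z, ρ z = 0 := by
  have hbound : ∀ R : ℝ, 0 < R → r ≤ R → ∀ z : ℂ, R ≤ ‖z‖ → ‖f z‖ ≤ |C| / R ^ 2 := by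
    intro R hR hrR z hz
    refine (hC z (hrR.trans hz)).trans ?_
    gcongr
    exact le_abs_self C
  refine tendsto_nhds_unique (tendsto_integral_square hρ) ?_
  -- Four sides of length `2R`, on each of which `‖f‖ ≤ |C| / R²`.
  have hlim : Filter.Tendsto (fun R : ℝ => 8 * |C| / R) Filter.atTop (𝓝 0) :=
    Filter.Tendsto.const_div_atTop Filter.tendsto_id _
  refine squeeze_zero_norm' ?_ hlim
  filter_upwards [Filter.eventually_gt_atTop 0, Filter.eventually_ge_atTop r] with R hR hrR
  have key := Complex.integral_boundary_rect_of_differentiableOn_real f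
    (⟨-R, -R⟩ : ℂ) (⟨R, R⟩ : ℂ) hf.differentiableOn
    (by simp only [smul_eq_mul, hfρ]; exact hρ.integrableOn)
  simp only [smul_eq_mul, hfρ] at key
  rw [← key]
  have hR' : |R| = R := abs_of_pos hR
  have hside : ∀ g : ℝ → ℂ, (∀ x, R ≤ ‖g x‖) → ‖∫ x in (-R)..R, f (g x)‖ ≤ 2 * |C| / R := by
    intro g hg
    refine (intervalIntegral.norm_integral_le_of_norm_le_const (C := |C| / R ^ 2)
      fun x _ => hbound R hR hrR _ (hg x)).trans (le_of_eq ?_)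
    rw [sub_neg_eq_add, abs_of_pos (add_pos hR hR)]
    field_simp
    ring
  have h1 := hside (fun x => x + ((-R : ℝ) : ℂ) * Complex.I) fun x => by
    simpa [hR'] using norm_add_mul_I_ge_im x (-R)
  have h2 := hside (fun x => x + ((R : ℝ) : ℂ) * Complex.I) fun x => by
    simpa [hR'] using norm_add_mul_I_ge_im x R
  have h3 := hside (fun y => ((R : ℝ) : ℂ) + y * Complex.I) fun x => by
    simpa [hR'] using norm_add_mul_I_ge_re R x
  have h4 := hside (fun y => ((-R : ℝ) : ℂ) + y * Complex.I) fun x => by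
    simpa [hR'] using norm_add_mul_I_ge_re (-R) x
  refine (norm_sub_le _ _).trans ?_
  refine (add_le_add_left ((norm_add_le _ _).trans (add_le_add_left (norm_sub_le _ _) _)) _).trans ?_
  rw [norm_mul, norm_mul, Complex.norm_I, one_mul, one_mul]
  have : 8 * |C| / R = 2 * |C| / R + 2 * |C| / R + 2 * |C| / R + 2 * |C| / R := by ring
  rw [this]
  exact add_le_add (add_le_add (add_le_add h1 h2) h3) h4

/-- A locally integrable function on the plane that decays like `‖z‖⁻⁴` is integrable. -/
theorem integrable_of_continuous_of_decay {ρ : ℂ → ℝ} (hρ : Continuous ρ) {C : ℝ}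
    (h : ∀ᶠ z in Bornology.cobounded ℂ, |ρ z| ≤ C / ‖z‖ ^ 4) : MeasureTheory.Integrable ρ := by
  -- The comparison function is `(1 + ‖z‖²)⁻²`, integrable because its decay exponent `4` exceeds
  -- the real dimension `2`.
  have hi : MeasureTheory.Integrable fun z : ℂ => (1 + ‖z‖ ^ 2) ^ (-(4 : ℝ) / 2) :=
    integrable_rpow_neg_one_add_norm_sq (by rw [Complex.finrank_real_complex]; norm_num)
  refine hρ.locallyIntegrable.integrable_of_isBigO_cocompact (g := fun z : ℂ =>
    (1 + ‖z‖ ^ 2) ^ (-(4 : ℝ) / 2)) ?_ (hi.integrableAtFilter _)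
  rw [← Metric.cobounded_eq_cocompact]
  refine Asymptotics.IsBigO.of_bound (4 * |C|) ?_
  filter_upwards [h, Filter.hasBasis_cobounded_norm.mem_of_mem (i := 1) trivial] with z hz h1
  replace h1 : 1 ≤ ‖z‖ := h1
  rw [Real.norm_eq_abs, Real.norm_of_nonneg (by positivity)]
  have e : (1 + ‖z‖ ^ 2 : ℝ) ^ (-(4 : ℝ) / 2) = 1 / (1 + ‖z‖ ^ 2) ^ 2 := by
    rw [show (-(4 : ℝ) / 2) = -(2 : ℕ) by norm_num, Real.rpow_neg (by positivity),
      Real.rpow_natCast, one_div]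
  rw [e]
  refine hz.trans ?_
  rw [mul_one_div]
  refine (div_le_div_of_nonneg_right (le_abs_self C) (by positivity)).trans ?_
  rw [div_le_div_iff₀ (by positivity) (by positivity)]
  have h2 : (1 + ‖z‖ ^ 2) ^ 2 ≤ 4 * ‖z‖ ^ 4 := by
    have : 1 + ‖z‖ ^ 2 ≤ 2 * ‖z‖ ^ 2 := by nlinarith
    calc (1 + ‖z‖ ^ 2) ^ 2 ≤ (2 * ‖z‖ ^ 2) ^ 2 := by gcongr
      _ = 4 * ‖z‖ ^ 4 := by ring
  nlinarith [abs_nonneg C]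

/-! ### Global lifts and the Fubini–Study density -/

section Sphere

variable {V : Type*} [NormedAddCommGroup V] [InnerProductSpace ℂ V]

/-- `P` is an entire nowhere vanishing lift of the sphere `u`, with a pole of order `d` at infinity
whose leading coefficient represents `u ∞`: near infinity, `P z = z ^ d • H (1 / z)`. -/
structure IsGlobalLift (u : OnePoint ℂ → ℙ ℂ V) (P H : ℂ → V) (d : ℕ) : Prop where
  differentiable : Differentiable ℂ P
  eq_mk : ∀ z : ℂ, ∃ h : P z ≠ 0, u z = Projectivization.mk ℂ (P z) h
  analyticAt : AnalyticAt ℂ H 0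
  eq_mk_infty : ∃ h : H 0 ≠ 0, u ∞ = Projectivization.mk ℂ (H 0) h
  eq_pow_smul : ∀ᶠ z in Bornology.cobounded ℂ, P z = z ^ d • H z⁻¹

theorem abs_fubiniStudy_le (p a b : V) : |fubiniStudy p a b| ≤ 2 * ‖a‖ * ‖b‖ / ‖p‖ ^ 2 := by
  rcases eq_or_ne p 0 with rfl | hp
  · simp [fubiniStudy]
  have hp' : 0 < ‖p‖ := norm_pos_iff.2 hp
  refine (Complex.abs_im_le_norm _).trans ((norm_sub_le _ _).trans ?_)
  rw [norm_div, norm_div, norm_mul, norm_pow, norm_pow, Complex.norm_real, norm_norm]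
  have h1 := norm_inner_le_norm (𝕜 := ℂ) a b
  have h2 := norm_inner_le_norm (𝕜 := ℂ) a p
  have h3 := norm_inner_le_norm (𝕜 := ℂ) p b
  calc _ ≤ ‖a‖ * ‖b‖ / ‖p‖ ^ 2 + (‖a‖ * ‖p‖) * (‖p‖ * ‖b‖) / ‖p‖ ^ 4 := by gcongr
    _ = _ := by field_simp; ring

theorem inner_mul_inner_swap (p a : V) : ⟪a, p⟫_ℂ * ⟪p, a⟫_ℂ = ((‖⟪p, a⟫_ℂ‖ ^ 2 : ℝ) : ℂ) := by
  rw [← inner_conj_symm, mul_comm, Complex.mul_conj, Complex.normSq_eq_norm_sq]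

/-- On a complex direction the form is the squared norm of the component of `a` orthogonal to `p`,
divided by `‖p‖²`. -/
theorem fubiniStudy_I_smul (p a : V) : fubiniStudy p a (Complex.I • a) =
    ‖a‖ ^ 2 / ‖p‖ ^ 2 - ‖⟪p, a⟫_ℂ‖ ^ 2 / ‖p‖ ^ 4 := by
  have h1 : ⟪a, a⟫_ℂ = ((‖a‖ ^ 2 : ℝ) : ℂ) := by
    rw [inner_self_eq_norm_sq_to_K]; norm_cast
  rw [fubiniStudy, inner_smul_right, inner_smul_right, h1, mul_left_comm, inner_mul_inner_swap]
  have e : Complex.I * ((‖a‖ ^ 2 : ℝ) : ℂ) / (‖p‖ : ℂ) ^ 2 -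
      Complex.I * ((‖⟪p, a⟫_ℂ‖ ^ 2 : ℝ) : ℂ) / (‖p‖ : ℂ) ^ 4 =
      ((‖a‖ ^ 2 / ‖p‖ ^ 2 - ‖⟪p, a⟫_ℂ‖ ^ 2 / ‖p‖ ^ 4 : ℝ) : ℂ) * Complex.I := by
    push_cast; ring
  rw [e, Complex.im_ofReal_mul, Complex.I_im, mul_one]

theorem ofReal_fubiniStudy_I_smul (p a : V) :
    (fubiniStudy p a (Complex.I • a) : ℂ) =
      ⟪a, a⟫_ℂ / (‖p‖ : ℂ) ^ 2 - ⟪a, p⟫_ℂ * ⟪p, a⟫_ℂ / (‖p‖ : ℂ) ^ 4 := by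
  rw [fubiniStudy_I_smul, inner_mul_inner_swap, inner_self_eq_norm_sq_to_K]
  push_cast
  rfl

/-- Strict Cauchy–Schwarz: equality would make `a` a multiple of `p`. -/
theorem fubiniStudy_I_smul_pos {p a : V} (h : LinearIndependent ℂ ![p, a]) :
    0 < fubiniStudy p a (Complex.I • a) := by
  have hp : p ≠ 0 := by simpa using h.ne_zero 0
  have hp' : 0 < ‖p‖ := norm_pos_iff.2 hp
  have h2 : ‖⟪p, a⟫_ℂ‖ < ‖p‖ * ‖a‖ := by
    refine lt_of_le_of_ne (norm_inner_le_norm p a) fun he => ?_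
    have ha : a ≠ 0 := by simpa using h.ne_zero 1
    obtain ⟨r, -, hr⟩ := (norm_inner_eq_norm_iff hp ha).1 he
    have := LinearIndependent.pair_iff.1 h r (-1) (by rw [hr]; simp)
    simpa using this.2
  have h3 : ‖⟪p, a⟫_ℂ‖ ^ 2 < (‖p‖ * ‖a‖) ^ 2 := by gcongr
  rw [fubiniStudy_I_smul, sub_pos, div_lt_div_iff₀ (by positivity) (by positivity)]
  nlinarith [pow_pos hp' 2]

/-- `∂ log ‖P‖²`. -/
noncomputable def logGrad (P : ℂ → V) (z : ℂ) : ℂ := ⟪P z, deriv P z⟫_ℂ / ⟪P z, P z⟫_ℂ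

/-- `∂̄ ∂ log ‖P‖²` is the Fubini–Study density. -/
theorem dbar_logGrad {P : ℂ → V} [CompleteSpace V] (hP : Differentiable ℂ P) (h0 : ∀ z, P z ≠ 0) :
    Differentiable ℝ (logGrad P) ∧ ∀ z,
      Complex.I * fderiv ℝ (logGrad P) z 1 - fderiv ℝ (logGrad P) z Complex.I =
        2 * Complex.I * (fubiniStudy (P z) (deriv P z) (Complex.I • deriv P z) : ℂ) := by
  have hP' : Differentiable ℂ (deriv P) := hP.deriv
  have hd : ∀ z, HasFDerivAt P (((ContinuousLinearMap.toSpanSingleton ℂ (deriv P z))).restrictScalars ℝ) z :=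
    fun z => ((hP z).hasDerivAt.hasFDerivAt).restrictScalars ℝ
  have hd' : ∀ z, HasFDerivAt (deriv P)
      (((ContinuousLinearMap.toSpanSingleton ℂ (deriv (deriv P) z))).restrictScalars ℝ) z :=
    fun z => ((hP' z).hasDerivAt.hasFDerivAt).restrictScalars ℝ
  have hne : ∀ z, ⟪P z, P z⟫_ℂ ≠ 0 := fun z => inner_self_ne_zero.2 (h0 z)
  have hN := fun z => (hd z).inner ℂ (hd' z)
  have hD := fun z => (hd z).inner ℂ (hd z)
  have hdiff : Differentiable ℝ (logGrad P) := fun z => by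
    unfold logGrad
    simp only [div_eq_mul_inv]
    exact (hN z).differentiableAt.mul ((hD z).differentiableAt.inv (hne z))
  refine ⟨hdiff, fun z => ?_⟩
  -- Differentiating this product identity and using uniqueness of the derivative avoids the
  -- quotient rule.
  have hmul : (fun z => ⟪P z, deriv P z⟫_ℂ) = fun z => logGrad P z * ⟪P z, P z⟫_ℂ := by
    ext w
    exact (div_mul_cancel₀ _ (hne w)).symm
  have heq := (hN z).unique (by rw [hmul]; exact (hdiff z).hasFDerivAt.mul (hD z))
  have e1 := DFunLike.congr_fun heq 1
  have eI := DFunLike.congr_fun heq Complex.I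
  simp [fderivInnerCLM_apply, inner_smul_left, inner_smul_right] at e1 eI
  have hn : ⟪P z, P z⟫_ℂ = (‖P z‖ : ℂ) ^ 2 := inner_self_eq_norm_sq_to_K _
  have hn0 : (‖P z‖ : ℂ) ≠ 0 := by simpa using h0 z
  rw [ofReal_fubiniStudy_I_smul]
  have hl : logGrad P z * (‖P z‖ : ℂ) ^ 2 = ⟪P z, deriv P z⟫_ℂ := by
    rw [← hn]; exact div_mul_cancel₀ _ (hne z)
  rw [← hl, inner_self_eq_norm_sq_to_K (𝕜 := ℂ) (deriv P z)]
  refine mul_left_cancel₀ (pow_ne_zero 2 hn0) ?_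
  have e : (‖P z‖ : ℂ) ^ 2 * (2 * Complex.I * ((‖deriv P z‖ : ℂ) ^ 2 / (‖P z‖ : ℂ) ^ 2 -
      ⟪deriv P z, P z⟫_ℂ * (logGrad P z * (‖P z‖ : ℂ) ^ 2) / (‖P z‖ : ℂ) ^ 4)) =
      2 * Complex.I * ((‖deriv P z‖ : ℂ) ^ 2 - ⟪deriv P z, P z⟫_ℂ * logGrad P z) := by
    field_simp
  refine Eq.trans ?_ e.symm
  -- This combination of the two directional derivatives is the `∂̄`-part, in which the terms with
  -- the second derivative of `P` cancel.
  linear_combination eI - Complex.I * e1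

/-- Complements of closed balls are open; this allows identities valid near infinity to be
differentiated. -/
theorem eventually_cobounded_nhds {p : ℂ → Prop} (h : ∀ᶠ z in Bornology.cobounded ℂ, p z) :
    ∀ᶠ z in Bornology.cobounded ℂ, ∀ᶠ w in 𝓝 z, p w := by
  obtain ⟨r, -, hr⟩ := (Metric.hasBasis_cobounded_compl_closedBall (0 : ℂ)).eventually_iff.1 h
  refine (Metric.hasBasis_cobounded_compl_closedBall (0 : ℂ)).eventually_iff.2
    ⟨r, trivial, fun z hz => ?_⟩
  filter_upwards [Metric.isClosed_closedBall.isOpen_compl.mem_nhds hz] with w hw using hr hw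

/-! ### Behaviour at infinity; area is proportional to degree -/

namespace IsGlobalLift

variable {u : OnePoint ℂ → ℙ ℂ V} {P H : ℂ → V} {d : ℕ}

theorem ne_zero (h : IsGlobalLift u P H d) (z : ℂ) : P z ≠ 0 := (h.eq_mk z).1

theorem ne_zero_infty (h : IsGlobalLift u P H d) : H 0 ≠ 0 := h.eq_mk_infty.1

theorem isLocalLift [CompleteSpace V] (h : IsGlobalLift u P H d) (z : ℂ) :
    IsLocalLift (fun w => u (w : OnePoint ℂ)) P z :=
  ⟨h.differentiable.analyticAt z, Filter.Eventually.of_forall h.eq_mk⟩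

theorem areaDensity_eq [CompleteSpace V] (h : IsGlobalLift u P H d) (z : ℂ) :
    areaDensity u z = fubiniStudy (P z) (deriv P z) (Complex.I • deriv P z) :=
  ChoreographicSphere.areaDensity_eq u z P (h.isLocalLift z)

/-- Near infinity the logarithmic derivative of `P` is `d / z`, up to an error `O(z⁻²)`. -/
theorem exists_norm_deriv_sub_le [CompleteSpace V] (h : IsGlobalLift u P H d) :
    ∃ C : ℝ, ∀ᶠ z in Bornology.cobounded ℂ,
      ‖deriv P z - (d / z : ℂ) • P z‖ ≤ C / ‖z‖ ^ 2 * ‖P z‖ := by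
  have hH0 := norm_pos_iff.2 h.ne_zero_infty
  have hq : ContinuousAt (fun w => ‖deriv H w‖ / ‖H w‖) 0 :=
    h.analyticAt.deriv.continuousAt.norm.div h.analyticAt.continuousAt.norm hH0.ne'
  have ev : ∀ᶠ w in 𝓝 (0 : ℂ), ‖deriv H w‖ / ‖H w‖ < ‖deriv H 0‖ / ‖H 0‖ + 1 ∧
      DifferentiableAt ℂ H w ∧ H w ≠ 0 :=
    (hq.eventually_lt_const (lt_add_one _)).and
      ((h.analyticAt.eventually_analyticAt.mono fun w hw => hw.differentiableAt).and
        (h.analyticAt.continuousAt.eventually_ne h.ne_zero_infty))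
  refine ⟨‖deriv H 0‖ / ‖H 0‖ + 1, ?_⟩
  filter_upwards [Filter.tendsto_inv₀_cobounded.eventually ev,
    eventually_cobounded_nhds h.eq_pow_smul, Bornology.eventually_ne_cobounded (0 : ℂ)]
    with z ⟨h1, h2, h3⟩ h4 hz
  have hPz : P z = z ^ d • H z⁻¹ := h4.self_of_nhds
  have hder : HasDerivAt (fun w => w ^ d • H w⁻¹)
      (z ^ d • ((-(z ^ 2)⁻¹) • deriv H z⁻¹) + (d * z ^ (d - 1) : ℂ) • H z⁻¹) z :=
    (hasDerivAt_pow d z).smul (HasDerivAt.scomp z h2.hasDerivAt (hasDerivAt_inv hz))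
  have hdP : deriv P z = _ := (Filter.EventuallyEq.deriv_eq h4).trans hder.deriv
  -- For `d = 0` the exponent `d - 1` truncates, but the factor `d` kills both sides.
  have hpow : (d * z ^ (d - 1) : ℂ) = d / z * z ^ d := by
    rcases d with _ | d
    · simp
    · rw [Nat.add_sub_cancel, pow_succ]; field_simp
  -- Subtracting `(d / z) • P` removes the derivative of `z ^ d`; what is left differentiates `H
  -- z⁻¹` and so carries `z⁻²`.
  have hS : deriv P z - (d / z : ℂ) • P z = z ^ d • ((-(z ^ 2)⁻¹) • deriv H z⁻¹) := by
    rw [hdP, hPz, hpow, mul_smul, add_sub_cancel_right]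
  have hHz := norm_pos_iff.2 h3
  have hle : ‖deriv H z⁻¹‖ ≤ (‖deriv H 0‖ / ‖H 0‖ + 1) * ‖H z⁻¹‖ :=
    (div_le_iff₀ hHz).1 h1.le
  rw [hS, hPz, norm_smul, norm_smul, norm_smul, norm_neg, norm_inv, norm_pow z 2]
  calc ‖z ^ d‖ * ((‖z‖ ^ 2)⁻¹ * ‖deriv H z⁻¹‖)
      ≤ ‖z ^ d‖ * ((‖z‖ ^ 2)⁻¹ * ((‖deriv H 0‖ / ‖H 0‖ + 1) * ‖H z⁻¹‖)) := by gcongr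
    _ = _ := by ring

theorem exists_norm_logGrad_sub_le [CompleteSpace V] (h : IsGlobalLift u P H d) :
    ∃ C : ℝ, ∀ᶠ z in Bornology.cobounded ℂ, ‖logGrad P z - d / z‖ ≤ C / ‖z‖ ^ 2 := by
  obtain ⟨C, hC⟩ := h.exists_norm_deriv_sub_le
  refine ⟨C, ?_⟩
  filter_upwards [hC] with z hz
  have hp := norm_pos_iff.2 (h.ne_zero z)
  have hpp : ⟪P z, P z⟫_ℂ ≠ 0 := inner_self_ne_zero.2 (h.ne_zero z)
  have e : logGrad P z - d / z = ⟪P z, deriv P z - (d / z : ℂ) • P z⟫_ℂ / ⟪P z, P z⟫_ℂ := by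
    rw [logGrad, inner_sub_right, inner_smul_right, sub_div, mul_div_cancel_right₀ _ hpp]
  have hn : ‖⟪P z, P z⟫_ℂ‖ = ‖P z‖ * ‖P z‖ := by
    rw [inner_self_eq_norm_sq_to_K, norm_pow]; simp [sq]
  rw [e, norm_div, hn, div_le_iff₀ (by positivity)]
  refine (norm_inner_le_norm _ _).trans ?_
  calc _ ≤ ‖P z‖ * (C / ‖z‖ ^ 2 * ‖P z‖) := by gcongr
    _ = _ := by ring

/-- By `fubiniStudy_rescale`, replacing `P'` by `P' - (d / z) • P` leaves the density unchanged. The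
new vector is `O(z⁻²) ‖P‖` and enters quadratically, so the density is `O(z⁻⁴)`. -/
theorem integrable_areaDensity [CompleteSpace V] (h : IsGlobalLift u P H d) :
    MeasureTheory.Integrable (areaDensity u) := by
  obtain ⟨C, hC⟩ := h.exists_norm_deriv_sub_le
  have hc : Continuous P := h.differentiable.continuous
  have hc' : Continuous (deriv P) := h.differentiable.deriv.continuous
  refine integrable_of_continuous_of_decay (C := 2 * C ^ 2) ?_ ?_
  · rw [funext h.areaDensity_eq]
    simp only [fubiniStudy_I_smul]
    have hn : ∀ z, ‖P z‖ ≠ 0 := fun z => norm_ne_zero_iff.2 (h.ne_zero z)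
    exact ((hc'.norm.pow 2).div (hc.norm.pow 2) fun z => pow_ne_zero 2 (hn z)).sub
      (((hc.inner hc').norm.pow 2).div (hc.norm.pow 4) fun z => pow_ne_zero 4 (hn z))
  · filter_upwards [hC, Bornology.eventually_ne_cobounded (0 : ℂ)] with z hz hz0
    have hp := norm_pos_iff.2 (h.ne_zero z)
    have hz' := norm_pos_iff.2 hz0
    have e := fubiniStudy_rescale (P z) (deriv P z) (Complex.I • deriv P z) (h.ne_zero z) 1
      (-(d / z)) (Complex.I * (-(d / z))) one_ne_zero
    simp only [one_smul, mul_smul, ← smul_add] at e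
    rw [h.areaDensity_eq, ← e]
    refine (abs_fubiniStudy_le _ _ _).trans ?_
    rw [neg_smul, ← sub_eq_add_neg, norm_smul, Complex.norm_I, one_mul,
      div_le_iff₀ (by positivity)]
    calc _ = 2 * ‖deriv P z - (d / z : ℂ) • P z‖ ^ 2 := by ring
      _ ≤ 2 * (C / ‖z‖ ^ 2 * ‖P z‖) ^ 2 := by gcongr
      _ = _ := by ring

/-- The areas of holomorphic spheres are proportional to their degrees. -/
theorem symplecticArea_mul [CompleteSpace V] {u' : OnePoint ℂ → ℙ ℂ V} {P' H' : ℂ → V} {d' : ℕ}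
    (h : IsGlobalLift u P H d) (h' : IsGlobalLift u' P' H' d') :
    d' * symplecticArea u = d * symplecticArea u' := by
  obtain ⟨hf, hρ⟩ := dbar_logGrad h.differentiable h.ne_zero
  obtain ⟨hf', hρ'⟩ := dbar_logGrad h'.differentiable h'.ne_zero
  obtain ⟨C, hC⟩ := h.exists_norm_logGrad_sub_le
  obtain ⟨C', hC'⟩ := h'.exists_norm_logGrad_sub_le
  -- The leading terms `d' d / z` cancel in this combination, which leaves the quadratic decay
  -- required by `integral_eq_zero_of_dbar`.
  have ev : ∀ᶠ z in Bornology.cobounded ℂ,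
      ‖d' * logGrad P z - d * logGrad P' z‖ ≤ (d' * C + d * C') / ‖z‖ ^ 2 := by
    filter_upwards [hC, hC'] with z hz hz'
    have e : d' * logGrad P z - d * logGrad P' z =
        d' * (logGrad P z - d / z) - d * (logGrad P' z - d' / z) := by ring
    rw [e]
    refine (norm_sub_le _ _).trans ?_
    rw [norm_mul, norm_mul, Complex.norm_natCast, Complex.norm_natCast]
    calc _ ≤ d' * (C / ‖z‖ ^ 2) + d * (C' / ‖z‖ ^ 2) := by gcongr
      _ = _ := by ring
  obtain ⟨r, -, hr⟩ := Filter.hasBasis_cobounded_norm.eventually_iff.1 ev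
  have hi := h.integrable_areaDensity
  have hi' := h'.integrable_areaDensity
  have key := integral_eq_zero_of_dbar
    (f := fun z => d' * logGrad P z - d * logGrad P' z)
    (ρ := fun z => ((2 * (d' * areaDensity u z - d * areaDensity u' z) : ℝ) : ℂ) * Complex.I)
    ((hf.const_mul _).sub (hf'.const_mul _)) (fun z => ?_)
    ((((hi.const_mul _).sub (hi'.const_mul _)).const_mul _).ofReal.mul_const _)
    (C := d' * C + d * C') (r := r) fun z hz => hr hz
  · rw [MeasureTheory.integral_mul_const, integral_complex_ofReal] at key
    have key' := Complex.ofReal_eq_zero.1 ((mul_eq_zero.1 key).resolve_right Complex.I_ne_zero)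
    rw [MeasureTheory.integral_const_mul,
      MeasureTheory.integral_sub (hi.const_mul _) (hi'.const_mul _),
      MeasureTheory.integral_const_mul, MeasureTheory.integral_const_mul] at key'
    unfold symplecticArea
    linarith
  · rw [fderiv_fun_sub ((hf z).const_mul _) ((hf' z).const_mul _), fderiv_const_mul (hf z),
      fderiv_const_mul (hf' z), h.areaDensity_eq, h'.areaDensity_eq]
    simp only [sub_apply, smul_apply, smul_eq_mul]
    push_cast
    linear_combination (d' : ℂ) * hρ z - d * hρ' z

end IsGlobalLift

/-! ### Hyperplane sections and existence of a global lift -/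

theorem inner_rep_eq_zero_iff (p : V) {x : ℙ ℂ V} {v : V} (hv : v ≠ 0)
    (hx : x = Projectivization.mk ℂ v hv) : ⟪p, x.rep⟫_ℂ = 0 ↔ ⟪p, v⟫_ℂ = 0 := by
  obtain ⟨a, ha⟩ := Projectivization.exists_smul_eq_mk_rep ℂ v hv
  rw [hx, ← ha, Units.smul_def, inner_smul_right, mul_eq_zero]
  simp

theorem chartAtInfty_inv {z : ℂ} (hz : z ≠ 0) : chartAtInfty z⁻¹ = (z : OnePoint ℂ) := by
  simp [chartAtInfty, hz]

theorem IsLocalLift.analyticAt_inner {g : ℂ → ℙ ℂ V} {U : ℂ → V} {z₀ : ℂ}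
    (h : IsLocalLift g U z₀) (p : V) : AnalyticAt ℂ (fun z => ⟪p, U z⟫_ℂ) z₀ :=
  ((innerSL ℂ p).analyticAt _).comp h.1

/-- The points of the plane mapped into the hyperplane orthogonal to `p`. -/
def hyperplaneSection (p : V) (u : OnePoint ℂ → ℙ ℂ V) : Set ℂ :=
  {z | ⟪p, (u z).rep⟫_ℂ = 0}

theorem IsLocalLift.eventually_mem_iff {p : V} {u : OnePoint ℂ → ℙ ℂ V} {U : ℂ → V} {z₀ : ℂ}
    (h : IsLocalLift (fun z => u (z : OnePoint ℂ)) U z₀) :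
    ∀ᶠ z in 𝓝 z₀, z ∈ hyperplaneSection p u ↔ ⟪p, U z⟫_ℂ = 0 := by
  filter_upwards [h.2] with z ⟨hz, e⟩
  exact inner_rep_eq_zero_iff p hz e

/-- A holomorphic sphere meets the complement of a hyperplane near infinity if it does so at
infinity. -/
theorem eventually_notMem_hyperplaneSection {p : V} {u : OnePoint ℂ → ℙ ℂ V} {U : ℂ → V}
    (h : IsLocalLift (fun w => u (chartAtInfty w)) U 0) (hp : ⟪p, U 0⟫_ℂ ≠ 0) :
    ∀ᶠ z in Bornology.cobounded ℂ, z ∉ hyperplaneSection p u := by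
  have ev := h.2.and ((h.analyticAt_inner p).continuousAt.eventually_ne hp)
  filter_upwards [Filter.tendsto_inv₀_cobounded.eventually ev,
    Bornology.eventually_ne_cobounded (0 : ℂ)] with z ⟨⟨hz, e⟩, hne⟩ hz0
  rw [chartAtInfty_inv hz0] at e
  exact fun hmem => hne ((inner_rep_eq_zero_iff p hz e).1 hmem)

/-- A holomorphic sphere not contained in a hyperplane meets it in isolated points. -/
theorem eventually_notMem_punctured {p : V} {u : OnePoint ℂ → ℙ ℂ V} (hu : IsHolomorphicSphere u)
    (hne : (hyperplaneSection p u)ᶜ.Nonempty) (z₀ : ℂ) :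
    ∀ᶠ z in 𝓝[≠] z₀, z ∉ hyperplaneSection p u := by
  have dich : ∀ z₀ : ℂ, (∀ᶠ z in 𝓝 z₀, z ∈ hyperplaneSection p u) ∨
      ∀ᶠ z in 𝓝[≠] z₀, z ∉ hyperplaneSection p u := by
    intro z₀
    obtain ⟨U, hU⟩ := hu.1 z₀
    refine (hU.analyticAt_inner p).eventually_eq_zero_or_eventually_ne_zero.imp (fun h => ?_)
      fun h => ?_
    · filter_upwards [h, hU.eventually_mem_iff (p := p)] with z h1 h2 using h2.2 h1
    · filter_upwards [h, (hU.eventually_mem_iff (p := p)).filter_mono nhdsWithin_le_nhds]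
        with z h1 h2 using fun h3 => h1 (h2.1 h3)
  -- Identity theorem by connectedness of the plane: by `dich` this interior is clopen, hence empty
  -- or everything.
  have hclopen : IsClopen (interior (hyperplaneSection p u)) := by
    refine ⟨isClosed_of_closure_subset fun z hz => ?_, isOpen_interior⟩
    rcases dich z with h | h
    · exact mem_interior_iff_mem_nhds.2 h
    · exfalso
      have hz' : z ∉ interior (hyperplaneSection p u) := fun hmem => by
        have h1 : ∀ᶠ w in 𝓝[≠] z, w ∈ hyperplaneSection p u :=
          Filter.Eventually.filter_mono nhdsWithin_le_nhds (mem_interior_iff_mem_nhds.1 hmem)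
        obtain ⟨w, hw, hw'⟩ := (h.and h1).exists
        exact hw hw'
      refine mem_closure_iff_frequently.1 hz ?_
      filter_upwards [eventually_nhdsWithin_iff.1 h] with w hw hmem
      rcases eq_or_ne w z with rfl | hwz
      · exact hz' hmem
      · exact hw hwz (interior_subset hmem)
  rcases isClopen_iff.1 hclopen with h | h
  · refine (dich z₀).resolve_left fun h' => ?_
    have : z₀ ∈ interior (hyperplaneSection p u) := mem_interior_iff_mem_nhds.2 h'
    rw [h] at this
    exact this
  · obtain ⟨z, hz⟩ := hne
    exact absurd (interior_subset (h ▸ Set.mem_univ z)) hz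

/-- The section is bounded, since `u ∞` lies off the hyperplane, and has no accumulation point;
compactness makes it finite. -/
theorem finite_hyperplaneSection {p : V} {u : OnePoint ℂ → ℙ ℂ V} (hu : IsHolomorphicSphere u)
    {U : ℂ → V} (h : IsLocalLift (fun w => u (chartAtInfty w)) U 0) (hp : ⟪p, U 0⟫_ℂ ≠ 0) :
    (hyperplaneSection p u).Finite := by
  have hev := eventually_notMem_hyperplaneSection h hp
  obtain ⟨r, -, hr⟩ := (Metric.hasBasis_cobounded_compl_closedBall (0 : ℂ)).eventually_iff.1 hev
  by_contra hinf
  obtain ⟨x, -, hx⟩ := Set.Infinite.exists_accPt_of_subset_isCompact hinf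
    (isCompact_closedBall (0 : ℂ) r) fun z hz => by
      by_contra hz'
      exact hr hz' hz
  exact (accPt_iff_frequently_nhdsNE.1 hx) (eventually_notMem_punctured hu hev.exists x)

/-- A local lift, with the vanishing order of its pairing with `p` split off. -/
theorem exists_lift_inner_eq_pow_mul {p : V} {u : OnePoint ℂ → ℙ ℂ V} (hu : IsHolomorphicSphere u)
    (hne : (hyperplaneSection p u)ᶜ.Nonempty) (z₀ : ℂ) :
    ∃ (U : ℂ → V) (h : ℂ → ℂ) (n : ℕ), IsLocalLift (fun z => u (z : OnePoint ℂ)) U z₀ ∧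
      AnalyticAt ℂ h z₀ ∧ h z₀ ≠ 0 ∧ (z₀ ∉ hyperplaneSection p u → n = 0) ∧
      ∀ᶠ z in 𝓝 z₀, ⟪p, U z⟫_ℂ = (z - z₀) ^ n * h z := by
  obtain ⟨U, hU⟩ := hu.1 z₀
  have hiff := hU.eventually_mem_iff (p := p)
  obtain ⟨n, h, han, hh0, heq⟩ := (hU.analyticAt_inner p).exists_eventuallyEq_pow_smul_nonzero_iff.2
    fun h0 => by
      have h1 := (hiff.and h0).filter_mono (nhdsWithin_le_nhds (s := {z₀}ᶜ))
      obtain ⟨z, hz, hz'⟩ := ((eventually_notMem_punctured hu hne z₀).and h1).exists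
      exact hz (hz'.1.2 hz'.2)
  refine ⟨U, h, n, hU, han, hh0, fun hz => ?_, heq⟩
  by_contra hn
  have := heq.self_of_nhds
  rw [sub_self, zero_pow hn, zero_smul] at this
  exact hz (hiff.self_of_nhds.2 this)

/-- Take the hyperplane orthogonal to a representative `p` of `u ∞`, which misses `u ∞` and so meets
the sphere in finitely many points. Requiring the pairing of the lift with `p` to be the monic
polynomial with these zeros and multiplicities fixes the lift off the zeros, so local lifts glue.
The degree is the number of zeros with multiplicity. -/
theorem exists_isGlobalLift [CompleteSpace V] {u : OnePoint ℂ → ℙ ℂ V}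
    (hu : IsHolomorphicSphere u) : ∃ P H d, IsGlobalLift u P H d := by
  obtain ⟨U', hU'⟩ := hu.2
  obtain ⟨hU'0, hu'⟩ := hU'.2.self_of_nhds
  set p := U' 0
  have hp : ⟪p, U' 0⟫_ℂ ≠ 0 := inner_self_ne_zero.2 hU'0
  have hfin := finite_hyperplaneSection hu hU' hp
  have hev := eventually_notMem_hyperplaneSection hU' hp
  choose U h n hU han hh0 hn heq using exists_lift_inner_eq_pow_mul hu hev.exists
  set Z := hfin.toFinset with hZ
  have hZmem : ∀ z, z ∈ Z ↔ z ∈ hyperplaneSection p u := fun z => hfin.mem_toFinset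
  -- The polynomial without its factor at `c`: it does not vanish at `c`, so rescaling by it keeps
  -- the lift nonzero there.
  set Q : ℂ → ℂ → ℂ := fun c z => ∏ x ∈ Z.erase c, (z - x) ^ n x with hQ
  have hQmul : ∀ c z, (z - c) ^ n c * Q c z = ∏ x ∈ Z, (z - x) ^ n x := by
    intro c z
    by_cases hc : c ∈ Z
    · exact Finset.mul_prod_erase Z (fun x => (z - x) ^ n x) hc
    · rw [hn c (fun h => hc ((hZmem c).2 h)), pow_zero, one_mul, hQ]
      simp only [Finset.erase_eq_of_notMem hc]
  have hQself : ∀ c, Q c c ≠ 0 := fun c => Finset.prod_ne_zero_iff.2 fun x hx =>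
    pow_ne_zero _ (sub_ne_zero.2 (Finset.ne_of_mem_erase hx).symm)
  have hQan : ∀ c z, AnalyticAt ℂ (Q c) z := fun c z =>
    Finset.analyticAt_fun_prod _ fun x _ => (analyticAt_id.sub analyticAt_const).pow _
  -- the lift on which the pairing with `p` is the polynomial `∏ (z - x) ^ n x`
  set F : ℂ → ℂ → V := fun c z => (Q c z / h c z) • U c z with hF
  have hFan : ∀ c, AnalyticAt ℂ (F c) c := fun c =>
    ((hQan c c).div (han c) (hh0 c)).smul (hU c).1
  have hFp : ∀ c, ∀ᶠ z in 𝓝 c, ⟪p, F c z⟫_ℂ = ∏ x ∈ Z, (z - x) ^ n x := by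
    intro c
    filter_upwards [heq c, (han c).continuousAt.eventually_ne (hh0 c)] with z h1 h2
    rw [hF, inner_smul_right, h1, ← hQmul c z]
    field_simp
  have hFlift : ∀ c, IsLocalLift (fun z => u (z : OnePoint ℂ)) (F c) c := by
    refine fun c => ⟨hFan c, ?_⟩
    filter_upwards [(hU c).2, (han c).continuousAt.eventually_ne (hh0 c),
      (hQan c c).continuousAt.eventually_ne (hQself c)] with z ⟨h1, e1⟩ h2 h3
    have h4 := div_ne_zero h3 h2
    refine ⟨smul_ne_zero h4 h1, e1.trans ?_⟩
    exact ((Projectivization.mk_eq_mk_iff' ℂ _ _ _ _).2 ⟨_, rfl⟩).symm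
  -- two lifts with the same nonzero pairing with `p` agree
  have huniq : ∀ (v w : V) (hv : v ≠ 0) (hw : w ≠ 0),
      Projectivization.mk ℂ v hv = Projectivization.mk ℂ w hw → ⟪p, v⟫_ℂ = ⟪p, w⟫_ℂ →
      ⟪p, w⟫_ℂ ≠ 0 → v = w := by
    intro v w hv hw e e' h0
    obtain ⟨a, rfl⟩ := (Projectivization.mk_eq_mk_iff' ℂ _ _ _ _).1 e
    rw [inner_smul_right] at e'
    rw [mul_eq_right₀ h0 |>.1 e', one_smul]
  have hprod : ∀ z, z ∉ hyperplaneSection p u → ∏ x ∈ Z, (z - x) ^ n x ≠ 0 := fun z hz =>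
    Finset.prod_ne_zero_iff.2 fun x hx => pow_ne_zero _
      (sub_ne_zero.2 fun e => hz (e ▸ (hZmem x).1 hx))
  -- The glued lift is the diagonal `F z z`; near `c` it is `F c`, by uniqueness off the zeros and
  -- trivially at `c`.
  have hPF : ∀ c, (fun z => F z z) =ᶠ[𝓝 c] F c := by
    intro c
    have hpunct := eventually_nhdsWithin_iff.1 (eventually_notMem_punctured hu hev.exists c)
    filter_upwards [hpunct, hFp c, (hFlift c).2] with z h1 h2 ⟨h3, e3⟩
    rcases eq_or_ne z c with rfl | hzc
    · rfl
    obtain ⟨h4, e4⟩ := (hFlift z).2.self_of_nhds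
    refine huniq _ _ h4 h3 (e4.symm.trans e3) ?_ ?_
    · rw [h2, (hFp z).self_of_nhds]
    · rw [h2]; exact hprod z (h1 hzc)
  -- The lift at infinity, rescaled so that its pairing with `p` is the reversed polynomial.
  set H : ℂ → V := fun w => ((∏ x ∈ Z, (1 - w * x) ^ n x) / ⟪p, U' w⟫_ℂ) • U' w with hH
  have hH0 : H 0 = (⟪p, U' 0⟫_ℂ)⁻¹ • U' 0 := by simp [hH]
  refine ⟨fun z => F z z, H, ∑ x ∈ Z, n x, ?_, fun z => (hFlift z).2.self_of_nhds, ?_, ?_, ?_⟩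
  · exact fun c => ((hFan c).congr (hPF c).symm).differentiableAt
  · refine AnalyticAt.smul (AnalyticAt.div ?_ (hU'.analyticAt_inner p) hp) hU'.1
    exact Finset.analyticAt_fun_prod _ fun x _ =>
      (analyticAt_const.sub (analyticAt_id.mul analyticAt_const)).pow _
  · rw [hH0]
    refine ⟨smul_ne_zero (inv_ne_zero hp) hU'0, ?_⟩
    simp only [chartAtInfty, if_true] at hu'
    rw [hu']
    exact ((Projectivization.mk_eq_mk_iff' ℂ _ _ _ _).2 ⟨_, rfl⟩).symm
  · have ev := hU'.2.and ((hU'.analyticAt_inner p).continuousAt.eventually_ne hp)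
    filter_upwards [Filter.tendsto_inv₀_cobounded.eventually ev, hev,
      Bornology.eventually_ne_cobounded (0 : ℂ)] with z ⟨⟨h1, e1⟩, h2⟩ h3 hz
    rw [chartAtInfty_inv hz] at e1
    have hpow : z ^ (∑ x ∈ Z, n x) * ∏ x ∈ Z, (1 - z⁻¹ * x) ^ n x = ∏ x ∈ Z, (z - x) ^ n x := by
      rw [← Finset.prod_pow_eq_pow_sum, ← Finset.prod_mul_distrib]
      refine Finset.prod_congr rfl fun x _ => ?_
      rw [← mul_pow, mul_sub, mul_one, mul_inv_cancel_left₀ hz]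
    have hpH : ⟪p, z ^ (∑ x ∈ Z, n x) • H z⁻¹⟫_ℂ = ∏ x ∈ Z, (z - x) ^ n x := by
      rw [hH, inner_smul_right, inner_smul_right, div_mul_cancel₀ _ h2, hpow]
    obtain ⟨h4, e4⟩ := (hFlift z).2.self_of_nhds
    have h5 : z ^ (∑ x ∈ Z, n x) • H z⁻¹ ≠ 0 := fun h0 => by
      rw [h0, inner_zero_right] at hpH
      exact hprod z h3 hpH.symm
    refine huniq _ _ h4 h5 (e4.symm.trans (e1.trans ?_)) ?_ ?_
    · refine ((Projectivization.mk_eq_mk_iff' ℂ _ _ _ _).2 ?_).symm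
      rw [hH, smul_smul]
      exact ⟨_, rfl⟩
    · rw [hpH, (hFp z).self_of_nhds]
    · rw [hpH]; exact hprod z h3

theorem mk_eq_mk_of_smul {v w : V} {a : ℂ} (hv : v ≠ 0) (hw : w ≠ 0) (h : a • w = v) :
    Projectivization.mk ℂ v hv = Projectivization.mk ℂ w hw :=
  (Projectivization.mk_eq_mk_iff' ℂ _ _ _ _).2 ⟨a, h⟩

/-! ### Spheres of degree zero and one, by Liouville -/

namespace IsGlobalLift

variable {u : OnePoint ℂ → ℙ ℂ V} {P H : ℂ → V} {d : ℕ}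

/-- A holomorphic sphere of degree zero is constant. -/
theorem eq_const (h : IsGlobalLift u P H 0) (x : OnePoint ℂ) : u x = u ∞ := by
  have hlim : Filter.Tendsto P (Bornology.cobounded ℂ) (𝓝 (H 0)) := by
    refine (h.analyticAt.continuousAt.tendsto.comp Filter.tendsto_inv₀_cobounded).congr' ?_
    filter_upwards [h.eq_pow_smul] with z hz
    simp [hz]
  induction x using OnePoint.rec with
  | infty => rfl
  | coe z =>
    obtain ⟨h1, e1⟩ := h.eq_mk z
    obtain ⟨h2, e2⟩ := h.eq_mk_infty
    rw [e1, e2]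
    refine mk_eq_mk_of_smul (a := 1) _ _ ?_
    rw [one_smul]
    exact (h.differentiable.apply_eq_of_tendsto_cocompact z
      (Metric.cobounded_eq_cocompact (α := ℂ) ▸ hlim)).symm

/-- A lift of degree one is affine. -/
theorem eq_add_smul [CompleteSpace V] (h : IsGlobalLift u P H 1) (z : ℂ) :
    P z = P 0 + z • H 0 := by
  -- The difference quotient of `P` at `0` is entire and tends to `H 0` at infinity, hence is
  -- constant.
  have hg : Differentiable ℂ (dslope P 0) := fun w =>
    ((Complex.differentiableOn_dslope Filter.univ_mem).2
      h.differentiable.differentiableOn).differentiableAt Filter.univ_mem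
  have hlim : Filter.Tendsto (dslope P 0) (Bornology.cobounded ℂ) (𝓝 (H 0)) := by
    have h1 : Filter.Tendsto (fun z : ℂ => H z⁻¹ - z⁻¹ • P 0) (Bornology.cobounded ℂ)
        (𝓝 (H 0 - (0 : ℂ) • P 0)) :=
      (h.analyticAt.continuousAt.tendsto.comp Filter.tendsto_inv₀_cobounded).sub
        (Filter.tendsto_inv₀_cobounded.smul_const _)
    rw [zero_smul, sub_zero] at h1
    refine h1.congr' ?_
    filter_upwards [h.eq_pow_smul, Bornology.eventually_ne_cobounded (0 : ℂ)] with z hz h0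
    rw [dslope_of_ne _ h0, slope_def_module, hz, sub_zero, pow_one, smul_sub, inv_smul_smul₀ h0]
  have := hg.apply_eq_of_tendsto_cocompact z
    (Metric.cobounded_eq_cocompact (α := ℂ) ▸ hlim)
  have e := sub_smul_dslope P 0 z
  rw [this, sub_zero] at e
  rw [e, add_sub_cancel]

end IsGlobalLift

/-! ### Projective lines: minimality, uniqueness, symmetry -/

theorem add_smul_ne_zero {v w : V} (h : LinearIndependent ℂ ![v, w]) (z : ℂ) : v + z • w ≠ 0 :=
  fun h0 => one_ne_zero (LinearIndependent.pair_iff.1 h 1 z (by rwa [one_smul])).1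

/-- The projective line through `[v]` and `[w]`, parametrised by `z ↦ [v + z w]`. -/
noncomputable def lineSphere (v w : V) (h : LinearIndependent ℂ ![v, w]) : OnePoint ℂ → ℙ ℂ V :=
  fun x => x.elim (Projectivization.mk ℂ w (h.ne_zero 1))
    fun z => Projectivization.mk ℂ (v + z • w) (add_smul_ne_zero h z)

section Line

variable {v w : V} (h : LinearIndependent ℂ ![v, w])

theorem lineSphere_coe (z : ℂ) :
    lineSphere v w h z = Projectivization.mk ℂ (v + z • w) (add_smul_ne_zero h z) := rfl

theorem lineSphere_infty : lineSphere v w h ∞ = Projectivization.mk ℂ w (h.ne_zero 1) := rfl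

theorem isParametrizedLine_lineSphere : IsParametrizedLine v w (lineSphere v w h) :=
  ⟨fun z => ⟨add_smul_ne_zero h z, rfl⟩, h.ne_zero 1, rfl⟩

theorem isGlobalLift_lineSphere :
    IsGlobalLift (lineSphere v w h) (fun z => v + z • w) (fun t => t • v + w) 1 where
  differentiable := by fun_prop
  eq_mk := (isParametrizedLine_lineSphere h).1
  analyticAt := (analyticAt_id.smul analyticAt_const).add analyticAt_const
  eq_mk_infty := by
    simpa using (isParametrizedLine_lineSphere h).2
  eq_pow_smul := by
    filter_upwards [Bornology.eventually_ne_cobounded (0 : ℂ)] with z hz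
    rw [pow_one, smul_add, smul_inv_smul₀ hz]

theorem isHolomorphicSphere_lineSphere [CompleteSpace V] :
    IsHolomorphicSphere (lineSphere v w h) := by
  refine ⟨fun z => ⟨_, (isGlobalLift_lineSphere h).isLocalLift z⟩, fun t => t • v + w,
    (isGlobalLift_lineSphere h).analyticAt, Filter.Eventually.of_forall fun t => ?_⟩
  have hne : t • v + w ≠ 0 := fun h0 =>
    one_ne_zero (LinearIndependent.pair_iff.1 h t 1 (by rwa [one_smul])).2
  refine ⟨hne, ?_⟩
  rcases eq_or_ne t 0 with rfl | ht
  · simp [chartAtInfty, lineSphere_infty]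
  · simp only [chartAtInfty, ht, if_false, lineSphere_coe]
    refine mk_eq_mk_of_smul (a := t⁻¹) _ _ ?_
    rw [smul_add, inv_smul_smul₀ ht]

theorem injective_lineSphere : Function.Injective (lineSphere v w h) := by
  have hli := LinearIndependent.pair_iff.1 h
  have hinf : ∀ z : ℂ, lineSphere v w h z ≠ lineSphere v w h ∞ := by
    intro z e
    obtain ⟨a, ha⟩ := (Projectivization.mk_eq_mk_iff' ℂ _ _ _ _).1 e
    refine one_ne_zero (hli 1 (z - a) ?_).1
    rw [sub_smul, ha]
    module
  intro x y hxy
  induction x using OnePoint.rec with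
  | infty =>
    induction y using OnePoint.rec with
    | infty => rfl
    | coe y => exact absurd hxy.symm (hinf y)
  | coe x =>
    induction y using OnePoint.rec with
    | infty => exact absurd hxy (hinf x)
    | coe y =>
      obtain ⟨a, ha⟩ := (Projectivization.mk_eq_mk_iff' ℂ _ _ _ _).1 hxy
      have h1 := hli (a - 1) (a * y - x) (by
        rw [← sub_eq_zero.2 (show a • (v + y • w) = v + x • w from ha)]
        module)
      have ha1 : a = 1 := sub_eq_zero.1 h1.1
      rw [ha1, one_mul] at h1
      rw [sub_eq_zero.1 h1.2]

theorem isSimple_lineSphere : IsSimple (lineSphere v w h) := by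
  intro v' φ _ _ e
  exact Function.Injective.of_comp (e ▸ injective_lineSphere h)

theorem symplecticArea_lineSphere_pos [CompleteSpace V] :
    0 < symplecticArea (lineSphere v w h) := by
  have hG := isGlobalLift_lineSphere h
  have hpos : ∀ z, 0 < areaDensity (lineSphere v w h) z := by
    intro z
    have hd : deriv (fun z : ℂ => v + z • w) z = w := by
      simpa using ((hasDerivAt_id z).smul_const w).const_add v |>.deriv
    rw [hG.areaDensity_eq, hd]
    refine fubiniStudy_I_smul_pos (LinearIndependent.pair_iff.2 fun s t hst => ?_)
    have h1 := LinearIndependent.pair_iff.1 h s (s * z + t) (by rw [← hst]; module)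
    refine ⟨h1.1, ?_⟩
    simpa [h1.1] using h1.2
  refine (MeasureTheory.integral_pos_iff_support_of_nonneg (fun z => (hpos z).le)
    hG.integrable_areaDensity).2 ?_
  have hs : Function.support (areaDensity (lineSphere v w h)) = Set.univ :=
    Set.eq_univ_of_forall fun z => (hpos z).ne'
  rw [hs]
  exact isOpen_univ.measure_pos _ Set.univ_nonempty

/-- A sphere of degree `d` has `d` times the area of the line, and `d ≥ 1` unless it is constant. -/
theorem isSimpleMinimalSphere_lineSphere [CompleteSpace V] :
    IsSimpleMinimalSphere (lineSphere v w h) := by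
  have hpos := symplecticArea_lineSphere_pos h
  refine ⟨isHolomorphicSphere_lineSphere h, isSimple_lineSphere h, hpos, ?_, ?_⟩
  · rintro a ⟨u, hu, hnc, rfl⟩
    obtain ⟨P, H, d, hP⟩ := exists_isGlobalLift hu
    have e := hP.symplecticArea_mul (isGlobalLift_lineSphere h)
    have hd : d ≠ 0 := by
      rintro rfl
      exact hnc ⟨_, hP.eq_const⟩
    have hd' : (1 : ℝ) ≤ d := by exact_mod_cast Nat.one_le_iff_ne_zero.2 hd
    rw [Nat.cast_one, one_mul] at e
    rw [e]
    nlinarith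
  · refine fun b hb => hb ⟨_, isHolomorphicSphere_lineSphere h, ?_, rfl⟩
    rintro ⟨c, hc⟩
    exact OnePoint.infty_ne_coe (0 : ℂ)
      (injective_lineSphere h ((hc _).trans (hc _).symm))

/-- Equal area forces degree one, so the lift is affine; the two endpoint conditions make it `a • v
+ z • (b • w)`, and `ζ = b / a`. -/
theorem exists_eq_lineSphere_comp_dilation [CompleteSpace V] {u : OnePoint ℂ → ℙ ℂ V}
    (hu : IsSimpleMinimalSphere u)
    (h0 : u ((0 : ℂ) : OnePoint ℂ) = Projectivization.mk ℂ v (h.ne_zero 0))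
    (hinf : u ∞ = Projectivization.mk ℂ w (h.ne_zero 1)) :
    ∃ ζ : ℂ, ζ ≠ 0 ∧ u = lineSphere v w h ∘ dilation ζ := by
  obtain ⟨P, H, d, hP⟩ := exists_isGlobalLift hu.holomorphic
  have hpos := symplecticArea_lineSphere_pos h
  have e := hP.symplecticArea_mul (isGlobalLift_lineSphere h)
  rw [hu.minimal.2.unique (isSimpleMinimalSphere_lineSphere h).minimal.2] at e
  have hd : d = 1 := by exact_mod_cast (mul_right_cancel₀ hpos.ne' e).symm
  subst hd
  obtain ⟨h1, e1⟩ := hP.eq_mk 0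
  obtain ⟨h2, e2⟩ := hP.eq_mk_infty
  obtain ⟨a, ha⟩ := (Projectivization.mk_eq_mk_iff' ℂ _ _ _ _).1 (e1.symm.trans h0)
  obtain ⟨b, hb⟩ := (Projectivization.mk_eq_mk_iff' ℂ _ _ _ _).1 (e2.symm.trans hinf)
  have ha0 : a ≠ 0 := by rintro rfl; exact h1 (by rw [← ha, zero_smul])
  have hb0 : b ≠ 0 := by rintro rfl; exact h2 (by rw [← hb, zero_smul])
  refine ⟨b / a, div_ne_zero hb0 ha0, funext fun x => ?_⟩
  induction x using OnePoint.rec with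
  | infty => exact hinf
  | coe z =>
    obtain ⟨h3, e3⟩ := hP.eq_mk z
    rw [e3]
    refine mk_eq_mk_of_smul (a := a) _ _ ?_
    rw [hP.eq_add_smul z, ← ha, ← hb, smul_add, smul_smul, smul_smul]
    congr 2
    field_simp

/-- A linear map with eigenvectors `v` and `w` acts on the line through `[v]` and `[w]` by the
multiplication by the quotient of the eigenvalues. -/
theorem lineSphere_comp_dilation_comp_dilation {T : V →ₗ[ℂ] V} (hT : Function.Injective T)
    {a c : ℂ} (hv : T v = a • v) (hw : T w = (a * c) • w) (ζ : ℂ) :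
    (lineSphere v w h ∘ dilation ζ) ∘ dilation c =
      Projectivization.map T hT ∘ (lineSphere v w h ∘ dilation ζ) := by
  have hv0 : T v ≠ 0 := fun h0 => h.ne_zero 0 (hT (h0.trans (map_zero T).symm))
  have hw0 : T w ≠ 0 := fun h0 => h.ne_zero 1 (hT (h0.trans (map_zero T).symm))
  have ha0 : a ≠ 0 := by rintro rfl; exact hv0 (by rw [hv, zero_smul])
  have hac0 : a * c ≠ 0 := by intro h0; exact hw0 (by rw [hw, h0, zero_smul])
  funext x
  induction x using OnePoint.rec with
  | infty =>
    refine mk_eq_mk_of_smul (a := (a * c)⁻¹) (h.ne_zero 1) hw0 ?_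
    rw [hw, inv_smul_smul₀ hac0]
    rfl
  | coe z =>
    -- Here `T (v + ζ z • w) = a • (v + ζ c z • w)`.
    refine mk_eq_mk_of_smul (a := a⁻¹) (add_smul_ne_zero h (ζ * (c * z)))
      (w := T (v + (ζ * z) • w))
      (fun h0 => add_smul_ne_zero h (ζ * z) (hT (h0.trans (map_zero T).symm))) ?_
    rw [map_add, map_smul, hv, hw, smul_add, inv_smul_smul₀ ha0, smul_smul, smul_smul]
    congr 2
    field_simp

end Line

end Sphere

/-! ### Root vectors as eigenvectors of the cyclic permutation -/

theorem rootVector_apply (n m : ℕ) (j : Fin n) :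
    rootVector n m j = Complex.exp (2 * Real.pi * Complex.I / m) ^ ((j : ℕ) + 1) := by
  rw [← Complex.exp_nat_mul]
  change Complex.exp _ = Complex.exp _
  congr 1
  push_cast
  ring

/-- Lets the lemmas on root vectors cover the total collision as well. -/
theorem rootVector_one (n : ℕ) : rootVector n 1 = totalCollision n := by
  ext j
  rw [rootVector_apply, Nat.cast_one, div_one, Complex.exp_two_pi_mul_I, one_pow]
  rfl

/-- Shifting a geometric sequence by one place divides it by its ratio `ζ`; the entry that wraps
around fits because `ζ ^ n = 1`. -/
theorem sigmaTilde_rootVector {n m : ℕ} (hm : m ≠ 0) (hmn : m ∣ n) :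
    sigmaTilde n (rootVector n m) =
      (Complex.exp (2 * Real.pi * Complex.I / m))⁻¹ • rootVector n m := by
  set ζ := Complex.exp (2 * Real.pi * Complex.I / m) with hζ
  have hζ0 : ζ ≠ 0 := Complex.exp_ne_zero _
  have hζn : ζ ^ n = 1 :=
    ((Complex.isPrimitiveRoot_exp m hm).pow_eq_one_iff_dvd n).2 hmn
  ext i
  obtain ⟨j, rfl⟩ := (finRotate n).surjective i
  rw [sigmaTilde_apply, Equiv.symm_apply_apply, PiLp.smul_apply, smul_eq_mul,
    rootVector_apply, rootVector_apply, ← hζ, eq_inv_mul_iff_mul_eq₀ hζ0, ← pow_succ']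
  rcases n with _ | k
  · exact j.elim0
  rcases eq_or_ne j (Fin.last k) with rfl | hj
  · rw [finRotate_last, Fin.val_last, pow_succ, hζn, Fin.val_zero, zero_add, one_mul, pow_one]
  · rw [coe_finRotate_of_ne_last hj]

/-- The first two coordinates `(α, α²)` and `(β, β²)` suffice: `α ≠ β`, being primitive roots of
different orders. -/
theorem linearIndependent_of_rootVector {n m m' : ℕ} (hn : 2 ≤ n) (hm : m ≠ 0) (hm' : m' ≠ 0)
    (hmm' : m ≠ m') : LinearIndependent ℂ ![rootVector n m, rootVector n m'] := by
  set α := Complex.exp (2 * Real.pi * Complex.I / m) with hα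
  set β := Complex.exp (2 * Real.pi * Complex.I / m') with hβ
  have hα0 : α ≠ 0 := Complex.exp_ne_zero _
  have hβ0 : β ≠ 0 := Complex.exp_ne_zero _
  have hαβ : α - β ≠ 0 := sub_ne_zero.2 fun e => hmm'
    ((Complex.isPrimitiveRoot_exp m hm).unique
      (hα.symm.trans e ▸ Complex.isPrimitiveRoot_exp m' hm'))
  refine LinearIndependent.pair_iff.2 fun s t hst => ?_
  have h0 := congrArg (fun v : EuclideanSpace ℂ (Fin n) => v ⟨0, by omega⟩) hst
  have h1 := congrArg (fun v : EuclideanSpace ℂ (Fin n) => v ⟨1, by omega⟩) hst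
  simp only [PiLp.add_apply, PiLp.smul_apply, smul_eq_mul, rootVector_apply, PiLp.zero_apply,
    ← hα, ← hβ, zero_add, pow_one] at h0 h1
  have hs : s * (α * (α - β)) = 0 := by linear_combination h1 - β * h0
  have ht : t * (β * (α - β)) = 0 := by linear_combination α * h0 - h1
  exact ⟨(mul_eq_zero.1 hs).resolve_right (mul_ne_zero hα0 hαβ),
    (mul_eq_zero.1 ht).resolve_right (mul_ne_zero hβ0 hαβ)⟩

/-! ### Transfer to Lim's coordinates -/

namespace LimCoordinates

variable {k : ℕ} (L : LimCoordinates k)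

/-- The map `Z ↦ w(Z)` as a linear map. -/
noncomputable def coordsLinear : EuclideanSpace ℂ (Fin (k + 1)) →ₗ[ℂ] EuclideanSpace ℂ (Fin k) :=
  dropLast k ∘ₗ L.f.toLinearEquiv.toLinearMap

theorem coordsLinear_apply (Z : EuclideanSpace ℂ (Fin (k + 1))) : L.coordsLinear Z = L.coords Z :=
  rfl

/-- On vectors of coordinate sum zero the dropped coordinate is `0`, so `L.coords` loses nothing. -/
theorem linearIndependent_coords {Z Z' : EuclideanSpace ℂ (Fin (k + 1))} (hZ : ∑ i, Z i = 0)
    (hZ' : ∑ i, Z' i = 0) (h : LinearIndependent ℂ ![Z, Z']) :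
    LinearIndependent ℂ ![L.coords Z, L.coords Z'] := by
  refine LinearIndependent.pair_iff.2 fun s t hst => LinearIndependent.pair_iff.1 h s t ?_
  by_contra hne
  refine L.coords_ne_zero hne ?_ ?_
  · simp only [PiLp.add_apply, PiLp.smul_apply, Finset.sum_add_distrib, ← Finset.smul_sum, hZ, hZ',
      smul_zero, add_zero]
  · rw [← coordsLinear_apply, map_add, map_smul, map_smul]
    exact hst

theorem appendZero_coords {Z : EuclideanSpace ℂ (Fin (k + 1))} (hZ : ∑ i, Z i = 0) :
    appendZero k (L.coords Z) = L.f Z := by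
  ext i
  refine Fin.lastCases ?_ (fun j => ?_) i
  · rw [L.last_eq, hZ, zero_div]
    simp [appendZero]
  · rw [appendZero]
    simp only [LinearMap.coe_mk, AddHom.coe_mk, Fin.snoc_castSucc]
    rfl

/-- Carries eigenvectors of coordinate sum zero, with their eigenvalues, over to the reduced space.
-/
theorem permutation_coords {Z : EuclideanSpace ℂ (Fin (k + 1))} (hZ : ∑ i, Z i = 0) {a : ℂ}
    (h : sigmaTilde (k + 1) Z = a • Z) : L.permutation (L.coords Z) = a • L.coords Z := by
  have e : L.permutation (L.coords Z) =
      L.coords (sigmaTilde (k + 1) (L.f.symm (appendZero k (L.coords Z)))) := rfl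
  rw [e, L.appendZero_coords hZ, LinearIsometryEquiv.symm_apply_apply, h, ← coordsLinear_apply,
    map_smul, coordsLinear_apply]

end LimCoordinates

end ChoreographicSphere

/-! ### The two families of choreographic lines -/

theorem mainTheorem6 :
    (∀ (n : ℕ) [NeZero n], 2 ≤ n →
      ∃ u₀ : OnePoint ℂ → Projectivization ℂ (EuclideanSpace ℂ (Fin n)),
        ChoreographicSphere.IsParametrizedLine
          (ChoreographicSphere.polygon n) (ChoreographicSphere.totalCollision n) u₀ ∧
        ChoreographicSphere.IsSimpleMinimalSphere u₀ ∧
        ∀ u : OnePoint ℂ → Projectivization ℂ (EuclideanSpace ℂ (Fin n)),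
          ChoreographicSphere.IsSimpleMinimalSphere u →
          u ((0 : ℂ) : OnePoint ℂ) = ChoreographicSphere.polygonPoint n →
          u OnePoint.infty = ChoreographicSphere.totalCollisionPoint n →
          (∃ ζ : ℂ, ζ ≠ 0 ∧ u = u₀ ∘ ChoreographicSphere.dilation ζ) ∧
          ChoreographicSphere.IsChoreographic n (ChoreographicSphere.sigma₁ n) u) ∧
    (∀ (k m : ℕ) (hm : 2 ≤ m) (hn : k + 1 = 2 * m) (L : ChoreographicSphere.LimCoordinates k),
      ∃ u₀ : OnePoint ℂ → Projectivization ℂ (EuclideanSpace ℂ (Fin k)),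
        ChoreographicSphere.IsParametrizedLine
          (L.coords (ChoreographicSphere.binaryCollision (k + 1) m))
          (L.coords (ChoreographicSphere.polygon (k + 1))) u₀ ∧
        ChoreographicSphere.IsSimpleMinimalSphere u₀ ∧
        ∀ u : OnePoint ℂ → Projectivization ℂ (EuclideanSpace ℂ (Fin k)),
          ChoreographicSphere.IsSimpleMinimalSphere u →
          u ((0 : ℂ) : OnePoint ℂ) = L.binaryCollisionPoint m hm hn →
          u OnePoint.infty = L.polygonPoint (by omega) →
          (∃ ζ : ℂ, ζ ≠ 0 ∧ u = u₀ ∘ ChoreographicSphere.dilation ζ) ∧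
          ChoreographicSphere.IsChoreographic (k + 1) L.sigma₂ u) := by
  open ChoreographicSphere in
  refine ⟨fun n _ hn => ?_, fun k m hm hn L => ?_⟩
  · have hli : LinearIndependent ℂ ![polygon n, totalCollision n] := by
      rw [← rootVector_one]
      exact linearIndependent_of_rootVector hn (by omega) one_ne_zero (by omega)
    refine ⟨lineSphere _ _ hli, isParametrizedLine_lineSphere hli,
      isSimpleMinimalSphere_lineSphere hli, fun u hu h0 hinf => ?_⟩
    obtain ⟨ζ, hζ, rfl⟩ := exists_eq_lineSphere_comp_dilation hli hu h0 hinf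
    refine ⟨⟨ζ, hζ, rfl⟩, lineSphere_comp_dilation_comp_dilation hli _
      (sigmaTilde_rootVector (by omega) dvd_rfl) ?_ ζ⟩
    -- With `ε = e^{2πi/n}`, the eigenvalues are `ε⁻¹` on the polygon and `1` on the total
    -- collision, with quotient `ε`.
    rw [inv_mul_cancel₀ (Complex.exp_ne_zero _), ← rootVector_one]
    refine (sigmaTilde_rootVector one_ne_zero (one_dvd n)).trans ?_
    rw [Nat.cast_one, div_one, Complex.exp_two_pi_mul_I, inv_one]
  · have hm0 : m ≠ 0 := by omega
    have hdvd : m ∣ k + 1 := Dvd.intro_left 2 hn.symm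
    have hsA := sum_rootVector (k + 1) m hm hdvd
    have hsB := sum_rootVector (k + 1) (k + 1) (by omega) dvd_rfl
    have hli := L.linearIndependent_coords hsA hsB
      (linearIndependent_of_rootVector (by omega) hm0 (by omega) (by omega))
    refine ⟨lineSphere _ _ hli, isParametrizedLine_lineSphere hli,
      isSimpleMinimalSphere_lineSphere hli, fun u hu h0 hinf => ?_⟩
    obtain ⟨ζ, hζ, rfl⟩ := exists_eq_lineSphere_comp_dilation hli hu h0 hinf
    refine ⟨⟨ζ, hζ, rfl⟩, lineSphere_comp_dilation_comp_dilation hli _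
      (L.permutation_coords hsA (sigmaTilde_rootVector hm0 hdvd)) ?_ ζ⟩
    refine (L.permutation_coords hsB (sigmaTilde_rootVector (by omega) dvd_rfl)).trans ?_
    congr 1
    -- Since `n = 2m`, the eigenvalues are `ε⁻²` on the binary collision and `ε⁻¹` on the polygon,
    -- where `ε = e^{2πi/n}`; the quotient is again `ε`.
    have e : Complex.exp (2 * Real.pi * Complex.I / m) =
        Complex.exp (2 * Real.pi * Complex.I / (k + 1 : ℕ)) ^ 2 := by
      have hmC : (m : ℂ) ≠ 0 := Nat.cast_ne_zero.2 hm0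
      rw [← Complex.exp_nat_mul, hn]
      congr 1
      push_cast
      field_simp
    have h0 := Complex.exp_ne_zero (2 * Real.pi * Complex.I / (k + 1 : ℕ))
    rw [e]
    field_simp
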